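/- **Definitions.** For a binary vector $x$ of length $t$ (positions $0,\dots,t-1$), let $x(i)$ be its cyclic shift, whose bit at position $r$ is the bit of $x$ at $(r+i)\bmod t$; let $x^*=x(-1)\vee x\vee x(1)$; let $x_{[a,b]}$ be the part of $x$ at positions $a\le r\le b$, and let $|\cdot|$ be the number of ones. Let $0<\alpha\le 1$. A $t\times n$ binary matrix $M$ with $t\ge n$ and columns $[c_1],\dots,[c_n]$ is an *$(n,\alpha)$-ultra-resilient superimposed code (URSC) of elongation $\tau$*, where $0\le\tau(n,k)<t$, if for every $2\le k\le n$, every set $T$ of $k$ column indices, every $j\in T$ and every bitwise OR $z=\bigvee_{m\in T\setminus\{j\}}[c_m](i_m)$ of arbitrary cyclic shifts of the other columns, $$\big|([c_j]\wedge z^*)_{[0,\tau(n,k)]}\big|<\alpha\,\big|[c_j]_{[0,\tau(n,k)]}\big| .$$ **Algorithm.** On input $n\ge2$, $\alpha\in(0,1]$, $\varepsilon>0$, $c>0$, put $t=\lceil (c/\alpha^{2+\varepsilon})\,n^2\ln n\rceil$, $\tau_1(n,k)=\lfloor (c/64)k^2\ln n\rfloor$ and $\tau_2(n,k)=\min\big(\lfloor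 c\,(k^2/\alpha^{2+\varepsilon})\ln n\rfloor,\,t-1\big)$. Repeat the following: generate a fresh random $t\times n$ binary matrix with independent entries, where each entry of row $r$ is $1$ with probability $1/\sqrt{\lfloor r/\ln n\rfloor+1}$; check for every $1<k\le n$, every ordered pair of distinct columns $j,j'$ and every shift $0\le i<t$, stopping at the first failure, that $$\big|[c_j]_{[0,\tau_1]}\big|\le\alpha\,\big|[c_j]_{[\tau_1,\tau_2]}\big|\quad\text{and}\quad \Big|\big([c_j]\wedge([c_{j'}](i-1)\vee[c_{j'}](i)\vee[c_{j'}](i+1))\big)_{[\tau_1,\tau_2]}\Big|\le\Big\lfloor\frac{\alpha\,|[c_j]_{[\tau_1,\tau_2]}|-1}{k-1}\Big\rfloor ,$$ where $\tau_1=\tau_1(n,k)$ and $\tau_2=\tau_2(n,k)$. Return the first matrix that passes all checks. The running time is the number of elementary operations (arithmetic operations and elementary functions on real numbers, comparisons, Boolean operations, reading or writing a bit, random choices of a bit with a given bias, loop steps), each of unit cost, over all executed rounds. **Theorem.** For every $\varepsilon>0$ there are $c_0>0$ and $d\in\mathbb N$ such that for every $c\ge c_0$ there is $C>0$ for which the following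 holds for all $\alpha\in(0,1]$ and all $n\ge2$. Run the algorithm with input $n,\ \alpha/2,\ \varepsilon,\ c$, and let $\tau(n,k)$ be its function $\tau_2(n,k)$ (computed with $\alpha/2$ in place of $\alpha$). Then 1. $\tau(n,k)\le C\,\dfrac{k^2}{\alpha^{2+\varepsilon}}\ln n$ for all $1<k\le n$; 2. every matrix the algorithm returns is an $(n,\alpha)$-URSC of elongation $\tau$ (simultaneously for all $1<k\le n$), and the algorithm returns a matrix with probability $1$; 3. with probability at least $1-1/n^2$ the algorithm returns an $(n,\alpha)$-URSC of elongation $\tau$ after at most $C\,(n/\alpha)^d$ operations; 4. the expected number of operations is at most $C\,(n/\alpha)^d$. -/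

import Mathlib

noncomputable section

namespace URSC

/-! ### Binary vectors and ultra-resilient superimposed codes

A `t × n` binary matrix is a function `M : Fin t → Fin n → Bool`; `M r j` is the bit in row `r` of
column `j`.  On vectors `Fin t → Bool`, `⊔` and `⊓` are the bitwise OR and AND. -/

/-- The `j`-th column (codeword) of a binary matrix. -/
def column {t n : ℕ} (M : Fin t → Fin n → Bool) (j : Fin n) : Fin t → Bool := fun r => M r j

/-- The cyclic shift `x(i)`: its bit at position `r` is the bit of `x` at `(r + i) mod t`. -/
def cyclicShift {t : ℕ} (x : Fin t → Bool) (i : ℤ) : Fin t → Bool := fun r =>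
  x ⟨(((r : ℤ) + i) % (t : ℤ)).toNat, by
    have ht : (0 : ℤ) < t := by have := r.isLt; omega
    have h1 := Int.emod_nonneg ((r : ℤ) + i) ht.ne'
    have h2 := Int.emod_lt_of_pos ((r : ℤ) + i) ht
    omega⟩

/-- The slipped vector `z* = z(-1) ∨ z ∨ z(1)`. -/
def slipped {t : ℕ} (z : Fin t → Bool) : Fin t → Bool :=
  cyclicShift z (-1) ⊔ z ⊔ cyclicShift z 1

/-- The number of ones of `x` in the positions `a, a + 1, …, b`. -/
def segWeight {t : ℕ} (x : Fin t → Bool) (a b : ℕ) : ℕ :=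
  (Finset.univ.filter fun r : Fin t => a ≤ (r : ℕ) ∧ (r : ℕ) ≤ b ∧ x r = true).card

/-- All superpositions (bitwise ORs) of one cyclic shift of each of the columns in `R`. -/
def superpositions {t n : ℕ} (M : Fin t → Fin n → Bool) (R : Finset (Fin n)) :
    Set (Fin t → Bool) :=
  {z | ∃ s : Fin n → ℤ, z = R.sup fun j => cyclicShift (column M j) (s j)}

/-- `M` is an `(n, α)`-ultra-resilient superimposed code of elongation `τ`. -/
structure IsURSC {t n : ℕ} (M : Fin t → Fin n → Bool) (α : ℝ) (τ : ℕ → ℕ → ℕ) : Prop where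
  le_length : n ≤ t
  alpha_pos : 0 < α
  alpha_le_one : α ≤ 1
  elongation_lt : ∀ k, 2 ≤ k → k ≤ n → τ n k < t
  resilient : ∀ k, 2 ≤ k → k ≤ n → ∀ T : Finset (Fin n), T.card = k → ∀ j ∈ T,
    ∀ z ∈ superpositions M (T.erase j),
      (segWeight (column M j ⊓ slipped z) 0 (τ n k) : ℝ) < α * segWeight (column M j) 0 (τ n k)

/-! ### The random matrix -/

/-- The number of rows: there is one row for each integer `r` with
`0 ≤ r < (c / α ^ (2 + ε)) n² ln n`. -/
def numRows (c ε α : ℝ) (n : ℕ) : ℕ := ⌈c / α ^ (2 + ε) * (n : ℝ) ^ 2 * Real.log n⌉₊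

/-- The probability `p(r) = √(1 / (⌊r / ln n⌋ + 1))` of a one in row `r`. -/
def prob (n r : ℕ) : ℝ := √(1 / ((⌊(r : ℝ) / Real.log n⌋₊ : ℝ) + 1))

lemma prob_mem_unitInterval (n r : ℕ) : prob n r ∈ unitInterval := by
  refine ⟨Real.sqrt_nonneg _, Real.sqrt_le_one.2 ?_⟩
  rw [div_le_one (by positivity)]
  linarith [Nat.cast_nonneg (α := ℝ) ⌊(r : ℝ) / Real.log n⌋₊]

/-- The law of the random `t × n` matrix: the entries are independent, and an entry of row `r` is
`1` with probability `p(r)`. -/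
def randomMatrix (t n : ℕ) : MeasureTheory.Measure (Fin t → Fin n → Bool) :=
  MeasureTheory.Measure.pi fun r : Fin t => MeasureTheory.Measure.pi fun _ : Fin n =>
    ProbabilityTheory.bernoulliMeasure true false
      (⟨prob n r, prob_mem_unitInterval n r⟩ : unitInterval)

instance (t n : ℕ) : MeasureTheory.IsProbabilityMeasure (randomMatrix t n) := by
  unfold randomMatrix; infer_instance

/-! ### Counting elementary operations

Unit-cost model over the real numbers: each of the following is one elementary operation: one
arithmetic operation on numbers (`+`, `-`, `*`, `/`, power, `√`, `ln`, rounding, remainder, `min`),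
one comparison, one Boolean operation, reading or writing one bit of a matrix, one random choice of
a bit that is `1` with a given probability, and the control of one pass of a loop. -/

/-- The result of a computation together with the number of elementary operations performed. -/
structure Timed (β : Type) where
  val : β
  steps : ℕ

namespace Timed

instance : Monad Timed where
  pure a := ⟨a, 0⟩
  bind x f := ⟨(f x.val).val, x.steps + (f x.val).steps⟩

/-- `a` is computed by `m` elementary operations. -/
def ops {β : Type} (m : ℕ) (a : β) : Timed β := ⟨a, m⟩

/-- `a` is computed by one elementary operation. -/
def op {β : Type} (a : β) : Timed β := ops 1 a

/-- `for i in l do s := body s i`. -/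
def fold {ι σ : Type} (body : σ → ι → Timed σ) : List ι → σ → Timed σ
  | [], s => pure s
  | i :: l, s => do
    let _ ← op ()
    let s' ← body s i
    fold body l s'

/-- `for i in l do if not (body i) then return false`, and then `return true`: the loop is left at
the first failure. -/
def all {ι : Type} (body : ι → Timed Bool) : List ι → Timed Bool
  | [] => pure true
  | i :: l => do
    let _ ← op ()
    let b ← body i
    if b then all body l else pure false

/-- `for i < m do a[i] := body i`, for an array `a` of length `m`: each pass costs the operations
of `body i`, one operation for the control of the loop and one for the writing. -/
def tabulate {β : Type} {m : ℕ} (body : Fin m → Timed β) : Timed (Fin m → β) :=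
  ⟨fun i => (body i).val, ∑ i, ((body i).steps + 2)⟩

end Timed

open Timed

/-! ### The algorithm -/

/-- `τ₁(n, k) = (c / 64) k² ln n`, rounded down to an integer. -/
def tau₁ (c : ℝ) (n k : ℕ) : ℕ := ⌊c / 64 * (k : ℝ) ^ 2 * Real.log n⌋₊

/-- `τ₂(n, k) = c (k² / α ^ (2 + ε)) ln n`, rounded down to a row index of the matrix, that
is, to an integer in `[0, t)`, where `t` is the number of rows. -/
def tau₂ (c ε α : ℝ) (n k : ℕ) : ℕ :=
  min ⌊c * ((k : ℝ) ^ 2 / α ^ (2 + ε)) * Real.log n⌋₊ (numRows c ε α n - 1)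

/-- Produce a matrix whose bits are the outcomes of the random choices `bits`: for each row `r`,
compute the probability `p(r)`, and for each column make a random choice with that probability. -/
def generate {t n : ℕ} (bits : Fin t → Fin n → Bool) : Timed (Fin t → Fin n → Bool) :=
  tabulate fun r : Fin t => do
    let _p ← ops 6 (prob n r)
    tabulate fun j : Fin n => op (bits r j)

/-- Count the ones in the positions `a, …, b` of a vector whose bits are computed by `x`. -/
def countOnes {t : ℕ} (x : Fin t → Timed Bool) (a b : ℕ) : Timed ℕ :=
  fold (fun (w : ℕ) (r : Fin t) => do
    let inside ← ops 3 (decide (a ≤ (r : ℕ)) && decide ((r : ℕ) ≤ b))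
    if inside then
      let bit ← x r
      if bit then op (w + 1) else pure w
    else pure w) (List.finRange t) 0

/-- Read a bit of a cyclic shift of column `j`: an addition, a remainder and one reading. -/
def readShifted {t n : ℕ} (M : Fin t → Fin n → Bool) (j : Fin n) (i : ℤ) (r : Fin t) :
    Timed Bool :=
  ops 3 (cyclicShift (column M j) i r)

/-- A bit of `[c_j] ∧ ([c_j'](i - 1) ∨ [c_j'](i) ∨ [c_j'](i + 1))`. -/
def readCollision {t n : ℕ} (M : Fin t → Fin n → Bool) (j j' : Fin n) (i : ℤ) (r : Fin t) :
    Timed Bool := do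
  let a ← op (M r j)
  let i₁ ← op (i - 1)
  let b₁ ← readShifted M j' i₁ r
  let b₂ ← readShifted M j' i r
  let i₃ ← op (i + 1)
  let b₃ ← readShifted M j' i₃ r
  ops 3 (a && (b₁ || b₂ || b₃))

/-- Test the Weight Inequality
`|[c_j]_[0, a]| ≤ α |[c_j]_[a, b]|` and the Collision Weight Inequality
`|([c_j] ∧ ([c_j'](i - 1) ∨ [c_j'](i) ∨ [c_j'](i + 1)))_[a, b]| ≤ ⌊(α |[c_j]_[a, b]| - 1) / (k - 1)⌋`
for one pair of columns and one shift. -/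
def checkPair {t n : ℕ} (M : Fin t → Fin n → Bool) (α : ℝ) (k a b : ℕ) (j j' : Fin n) (i : ℤ) :
    Timed Bool := do
  let top ← countOnes (fun r => op (M r j)) 0 a
  let bot ← countOnes (fun r => op (M r j)) a b
  let coll ← countOnes (fun r => readCollision M j j' i r) a b
  let bound ← op (α * (bot : ℝ))
  let weightIneq ← op (decide ((top : ℝ) ≤ bound))
  let q ← ops 4 ⌊(bound - 1) / ((k : ℝ) - 1)⌋
  let collisionIneq ← op (decide ((coll : ℤ) ≤ q))
  op (weightIneq && collisionIneq)

/-- `Check_P(M, α, τ₁, τ₂)`: test both inequalities for each `1 < k ≤ n`, each pair of distinct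
columns and each shift; stop at the first failure.  Here `[2, …, n]` is `List.range' 2 (n - 1)`. -/
def check {n : ℕ} (c ε α : ℝ) (M : Fin (numRows c ε α n) → Fin n → Bool) : Timed Bool :=
  all (fun k : ℕ => do
    let a ← ops 6 (tau₁ c n k)
    let b ← ops 10 (tau₂ c ε α n k)
    all (fun j : Fin n =>
      all (fun j' : Fin n => do
        let same ← op (decide (j = j'))
        if same then
          pure true
        else
          all (fun i : Fin (numRows c ε α n) => checkPair M α k a b j j' ((i : ℕ) : ℤ))
            (List.finRange (numRows c ε α n)))
        (List.finRange n))
      (List.finRange n))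
    (List.range' 2 (n - 1))

/-- One pass of the `repeat … until` loop: generate a random matrix and check it.  The result is
the matrix and the verdict. -/
def iteration {n : ℕ} (c ε α : ℝ) (bits : Fin (numRows c ε α n) → Fin n → Bool) :
    Timed ((Fin (numRows c ε α n) → Fin n → Bool) × Bool) := do
  let M ← generate bits
  let ok ← check c ε α M
  pure (M, ok)

/-- The sample space of the algorithm: `ω s r j` is the outcome of the random choice for the bit in
row `r` and column `j` in the `s`-th pass of the loop. -/
abbrev Sample (c ε α : ℝ) (n : ℕ) : Type := ℕ → Fin (numRows c ε α n) → Fin n → Bool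

/-- The passes of the loop use independent random matrices with the law `randomMatrix`. -/
def sampleLaw (c ε α : ℝ) (n : ℕ) : MeasureTheory.Measure (Sample c ε α n) :=
  MeasureTheory.Measure.infinitePi fun _ : ℕ => randomMatrix (numRows c ε α n) n

/-- The check succeeds in pass `s`. -/
def Accepts {c ε α : ℝ} {n : ℕ} (ω : Sample c ε α n) (s : ℕ) : Prop :=
  (iteration c ε α (ω s)).val.2 = true

open Classical in
/-- The output: the matrix of the first pass in which the check succeeds (`none` if the loop never
ends). -/
def output {c ε α : ℝ} {n : ℕ} (ω : Sample c ε α n) :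
    Option (Fin (numRows c ε α n) → Fin n → Bool) :=
  if h : ∃ s, Accepts ω s then some (iteration c ε α (ω (Nat.find h))).val.1 else none

open Classical in
/-- The running time: eight operations for the number of rows, and the operations of all passes that
are executed, that is, those before which no check has succeeded (and one more operation per pass
for the control of the loop).  It is `∞` if the loop never ends. -/
def runningTime {c ε α : ℝ} {n : ℕ} (ω : Sample c ε α n) : ENNReal :=
  8 + ∑' s : ℕ, if ∀ s' < s, ¬ Accepts ω s' then
    (((iteration c ε α (ω s)).steps + 1 : ℕ) : ENNReal) else 0

end URSC

end

noncomputable section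

namespace URSC

open Timed

/-! ### Values and operation counts -/

namespace Timed

/-! Correctness is deterministic. OR commutes with shifts, so z* is an OR of shift triples, one for
each of the k - 1 other columns. Let W be the weight of the chosen column in [τ₁, τ₂]. The k - 1
collision inequalities, tested with α/2, add up to at most (α/2)W - 1, and the weight inequality
bounds everything up to τ₁ by (α/2)W. The sum is strictly below αW (`isURSC_of_pairInequalities`).

For the probability of passing, let a = α/2 be the parameter of the run, L = ln n and G = √c · L ·
a^(-ε/2) (`scale`). The probability of a one in row r is about √(L/r), so the expected weight up to
position x is about 2√(Lx). Hence the expected weight up to τ₁ is at most (3/10)kG, and a times the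
expected weight in [τ₁, τ₂] is at least (9/5)kG. The expected number of collisions under one shift
is of order L(1 + ln(τ₂/τ₁)), whatever the shift, because the row probabilities decrease
(`sum_prob_mul_prob_comp_le`). The logarithm is of order 1 + ln(1/a), which the factor a^(-ε/2)
absorbs; this makes the expectation at most G/20 and is the reason for the extra ε in the exponent.

Chernoff bounds then make one test fail with probability at most 5e^(-G/5)
(`measureReal_not_pairInequalities_le`). There are at most n³t tests, and e^(-G/5) beats this
polynomial in n, c and a power of 1/a, again thanks to a^(-ε/2) (`union_bound_le`). So a round fails
with probability at most 1/n² ≤ 1/2. The first round alone gives the high-probability claim, and the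
geometric series over independent rounds gives almost sure termination and the expected time. -/

@[simp] lemma pure_val {β : Type} (a : β) : (pure a : Timed β).val = a := rfl
@[simp] lemma pure_steps {β : Type} (a : β) : (pure a : Timed β).steps = 0 := rfl
@[simp] lemma bind_val {β γ : Type} (x : Timed β) (f : β → Timed γ) :
    (x >>= f).val = (f x.val).val := rfl
@[simp] lemma bind_steps {β γ : Type} (x : Timed β) (f : β → Timed γ) :
    (x >>= f).steps = x.steps + (f x.val).steps := rfl
@[simp] lemma ops_val {β : Type} (m : ℕ) (a : β) : (ops m a).val = a := rfl
@[simp] lemma ops_steps {β : Type} (m : ℕ) (a : β) : (ops m a).steps = m := rfl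
@[simp] lemma op_val {β : Type} (a : β) : (op a).val = a := rfl
@[simp] lemma op_steps {β : Type} (a : β) : (op a).steps = 1 := rfl
lemma op_bind_val {β γ : Type} (a : β) (f : β → Timed γ) : (op a >>= f).val = (f a).val := rfl
lemma op_bind_steps {β γ : Type} (a : β) (f : β → Timed γ) :
    (op a >>= f).steps = 1 + (f a).steps := rfl
lemma ops_bind_val {β γ : Type} (m : ℕ) (a : β) (f : β → Timed γ) :
    (ops m a >>= f).val = (f a).val := rfl
lemma ops_bind_steps {β γ : Type} (m : ℕ) (a : β) (f : β → Timed γ) :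
    (ops m a >>= f).steps = m + (f a).steps := rfl

lemma all_val {ι : Type} (body : ι → Timed Bool) (l : List ι) :
    (all body l).val = true ↔ ∀ i ∈ l, (body i).val = true := by
  induction l with
  | nil => simp [all]
  | cons i l ih =>
    by_cases h : (body i).val = true <;> simp [all, h, ih]

lemma all_steps_le {ι : Type} {body : ι → Timed Bool} {B : ℕ} {l : List ι}
    (hB : ∀ i ∈ l, (body i).steps ≤ B) : (all body l).steps ≤ l.length * (B + 1) := by
  induction l with
  | nil => simp [all]
  | cons i l ih =>
    have h1 := hB i (by simp)
    have h2 := ih fun i' hi' => hB i' (by simp [hi'])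
    by_cases h : (body i).val = true
    · simp only [all, bind_steps, op_steps, h, if_true, List.length_cons]
      linarith
    · simp only [all, bind_steps, op_steps, if_neg h, List.length_cons, pure_steps]
      nlinarith [Nat.zero_le (l.length * (B + 1))]

lemma fold_steps_le {ι σ : Type} {body : σ → ι → Timed σ} {B : ℕ}
    (hB : ∀ s i, (body s i).steps ≤ B) (l : List ι) (s : σ) :
    (fold body l s).steps ≤ l.length * (B + 1) := by
  induction l generalizing s with
  | nil => simp [fold]
  | cons i l ih =>
    have h1 := hB s i
    have h2 := ih (body s i).val
    simp only [fold, bind_steps, op_steps, List.length_cons]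
    linarith

lemma fold_val {ι σ : Type} (body : σ → ι → Timed σ) (l : List ι) (s : σ) :
    (fold body l s).val = l.foldl (fun s i => (body s i).val) s := by
  induction l generalizing s with
  | nil => rfl
  | cons i l ih => simp [fold, ih]

end Timed

/-! ### Verdict and cost of the routines of the algorithm. -/

lemma countOnes_steps_le {t : ℕ} {x : Fin t → Timed Bool} {B : ℕ} (hB : ∀ r, (x r).steps ≤ B)
    (a b : ℕ) : (countOnes x a b).steps ≤ t * (B + 5) := by
  -- Three operations for the range test, B for the bit, one for the increment; the loop control
  -- adds the fifth.
  refine (fold_steps_le (B := B + 4) (fun w r => ?_) _ _).trans (by simp)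
  have := hB r
  rw [ops_bind_steps]
  split_ifs
  · rw [bind_steps]
    split_ifs
    · rw [op_steps]; omega
    · rw [pure_steps]; omega
  · rw [pure_steps]; omega

lemma countOnes_val {t : ℕ} (x : Fin t → Timed Bool) (a b : ℕ) :
    (countOnes x a b).val = segWeight (fun r => (x r).val) a b := by
  have key : ∀ (l : List (Fin t)) (w : ℕ),
      l.foldl (fun (w : ℕ) (r : Fin t) =>
        if a ≤ (r : ℕ) ∧ (r : ℕ) ≤ b ∧ (x r).val = true then w + 1 else w) w =
      w + l.countP (fun r : Fin t => a ≤ (r : ℕ) ∧ (r : ℕ) ≤ b ∧ (x r).val = true) := by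
    intro l
    induction l with
    | nil => simp
    | cons r l ih =>
      intro w
      rw [List.foldl_cons, ih, List.countP_cons]
      by_cases h : a ≤ (r : ℕ) ∧ (r : ℕ) ≤ b ∧ (x r).val = true
      · simp [h]; omega
      · simp [h]
  have hcount : segWeight (fun r => (x r).val) a b =
      (List.finRange t).countP (fun r : Fin t => a ≤ (r : ℕ) ∧ (r : ℕ) ≤ b ∧ (x r).val = true) := by
    rw [segWeight, Finset.card_def, Finset.filter_val, ← Multiset.countP_eq_card_filter]
    rfl
  rw [countOnes, Timed.fold_val, hcount, ← zero_add (List.countP _ _), ← key]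
  congr 1
  funext w r
  rw [ops_bind_val]
  by_cases h1 : a ≤ (r : ℕ) <;> by_cases h2 : (r : ℕ) ≤ b <;>
    by_cases h3 : (x r).val = true <;> simp [h1, h2, h3]

/-- The OR of three consecutive cyclic shifts. -/
def shiftTriple {t : ℕ} (x : Fin t → Bool) (i : ℤ) : Fin t → Bool :=
  cyclicShift x (i - 1) ⊔ cyclicShift x i ⊔ cyclicShift x (i + 1)

/-- The two inequalities that the algorithm tests for one pair of columns and one shift. -/
def PairInequalities {t n : ℕ} (M : Fin t → Fin n → Bool) (α : ℝ) (k a b : ℕ) (j j' : Fin n)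
    (i : ℤ) : Prop :=
  (segWeight (column M j) 0 a : ℝ) ≤ α * segWeight (column M j) a b ∧
    (segWeight (column M j ⊓ shiftTriple (column M j') i) a b : ℝ) ≤
      (α * segWeight (column M j) a b - 1) / ((k : ℝ) - 1)

lemma readCollision_val {t n : ℕ} (M : Fin t → Fin n → Bool) (j j' : Fin n) (i : ℤ) (r : Fin t) :
    (readCollision M j j' i r).val = (column M j ⊓ shiftTriple (column M j') i) r := rfl

lemma readCollision_steps {t n : ℕ} (M : Fin t → Fin n → Bool) (j j' : Fin n) (i : ℤ)
    (r : Fin t) : (readCollision M j j' i r).steps = 15 := rfl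

/-- The floor can be dropped because the collision count is an integer. -/
lemma checkPair_val {t n : ℕ} (M : Fin t → Fin n → Bool) (α : ℝ) (k a b : ℕ) (j j' : Fin n)
    (i : ℤ) : (checkPair M α k a b j j' i).val = true ↔ PairInequalities M α k a b j j' i := by
  simp only [checkPair, bind_val, op_val, ops_val, countOnes_val, readCollision_val,
    Bool.and_eq_true, decide_eq_true_eq, Int.le_floor, PairInequalities, Int.cast_natCast]
  exact and_congr_left fun _ => decide_eq_true_iff

lemma checkPair_steps_le {t n : ℕ} (M : Fin t → Fin n → Bool) (α : ℝ) (k a b : ℕ)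
    (j j' : Fin n) (i : ℤ) : (checkPair M α k a b j j' i).steps ≤ 32 * t + 8 := by
  have h1 := countOnes_steps_le (B := 1) (fun r : Fin t => (op_steps (M r j)).le) 0 a
  have h2 := countOnes_steps_le (B := 1) (fun r : Fin t => (op_steps (M r j)).le) a b
  have h3 := countOnes_steps_le (x := fun r => readCollision M j j' i r)
    (fun r => (readCollision_steps M j j' i r).le) a b
  simp only [checkPair, bind_steps, op_steps, ops_steps]
  linarith

lemma check_val {n : ℕ} (c ε α : ℝ) (M : Fin (numRows c ε α n) → Fin n → Bool) :
    (check c ε α M).val = true ↔ ∀ k, 2 ≤ k → k ≤ n → ∀ j j' : Fin n, j ≠ j' →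
      ∀ i : Fin (numRows c ε α n),
        PairInequalities M α k (tau₁ c n k) (tau₂ c ε α n k) j j' ((i : ℕ) : ℤ) := by
  simp only [check, all_val, List.mem_range'_1, ops_bind_val, op_bind_val,
    List.mem_finRange, true_imp_iff]
  refine forall_congr' fun k => ⟨fun h h2 hk j j' hj i => ?_, fun h hk j j' => ?_⟩
  · have := h ⟨h2, by omega⟩ j j'
    simp only [hj, decide_false, Bool.false_eq_true, if_false, all_val, List.mem_finRange,
      true_imp_iff] at this
    exact (checkPair_val ..).1 (this i)
  · by_cases hj : j = j'
    · simp [hj]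
    · simp only [hj, decide_false, Bool.false_eq_true, if_false, all_val, List.mem_finRange,
        true_imp_iff]
      exact fun i => (checkPair_val ..).2 (h hk.1 (by omega) j j' hj i)

lemma check_steps_le {n : ℕ} (c ε α : ℝ) (M : Fin (numRows c ε α n) → Fin n → Bool) :
    (check c ε α M).steps ≤
      n * (n * (n * (numRows c ε α n * (32 * numRows c ε α n + 9) + 2) + 1) + 17) := by
  rw [check]
  refine (all_steps_le (B := 16 +
    n * (n * (numRows c ε α n * (32 * numRows c ε α n + 9) + 2) + 1)) fun k _ => ?_).trans ?_
  · rw [ops_bind_steps, ops_bind_steps, ← add_assoc]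
    refine Nat.add_le_add_left ((all_steps_le (fun j _ => all_steps_le
      (B := numRows c ε α n * (32 * numRows c ε α n + 9) + 1) fun j' _ => ?_)).trans ?_) 16
    · rw [op_bind_steps]
      split_ifs
      · simp
      · have := all_steps_le (l := List.finRange (numRows c ε α n))
          (body := fun i : Fin (numRows c ε α n) =>
            checkPair M α k (tau₁ c n k) (tau₂ c ε α n k) j j' ((i : ℕ) : ℤ))
          fun i _ => checkPair_steps_le ..
        rw [List.length_finRange] at this
        linarith
    · simp
  · rw [List.length_range']
    refine Nat.mul_le_mul (Nat.sub_le _ _) (by omega)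

lemma generate_val {t n : ℕ} (bits : Fin t → Fin n → Bool) : (generate bits).val = bits := rfl

lemma generate_steps {t n : ℕ} (bits : Fin t → Fin n → Bool) :
    (generate bits).steps = t * (n * 3 + 8) := by
  simp [generate, tabulate]
  ring_nf
  tauto

lemma iteration_val {n : ℕ} (c ε α : ℝ) (bits : Fin (numRows c ε α n) → Fin n → Bool) :
    (iteration c ε α bits).val = (bits, (check c ε α bits).val) := rfl

lemma iteration_steps_le {n : ℕ} (c ε α : ℝ) (hn : 1 ≤ n) (ht : 1 ≤ numRows c ε α n)
    (bits : Fin (numRows c ε α n) → Fin n → Bool) :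
    (iteration c ε α bits).steps ≤ 72 * n ^ 3 * numRows c ε α n ^ 2 := by
  have h1 := generate_steps bits
  have h2 := check_steps_le c ε α bits
  have : (iteration c ε α bits).steps = (generate bits).steps + (check c ε α bits).steps := by
    simp [iteration, generate_val]
  rw [this, h1]
  set t := numRows c ε α n
  refine (Nat.add_le_add_left h2 _).trans ?_
  have e1 : n ≤ n ^ 3 := Nat.le_self_pow (by norm_num) n
  have e2 : n ^ 2 ≤ n ^ 3 := Nat.pow_le_pow_right hn (by norm_num)
  have e3 : t ≤ t ^ 2 := Nat.le_self_pow (by norm_num) t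
  have e4 : 1 ≤ t ^ 2 := Nat.one_le_pow _ _ ht
  have e5 : 1 ≤ n ^ 3 := Nat.one_le_pow _ _ hn
  have f1 : t * n ≤ n ^ 3 * t ^ 2 := by rw [mul_comm]; exact Nat.mul_le_mul e1 e3
  have f2 : t ≤ n ^ 3 * t ^ 2 := by simpa using Nat.mul_le_mul e5 e3
  have f3 : n ^ 3 * t ≤ n ^ 3 * t ^ 2 := Nat.mul_le_mul_left _ e3
  have f4 : n ^ 3 ≤ n ^ 3 * t ^ 2 := by simpa using Nat.mul_le_mul_left (n ^ 3) e4
  have f5 : n ^ 2 ≤ n ^ 3 * t ^ 2 := e2.trans f4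
  have f6 : n ≤ n ^ 3 * t ^ 2 := e1.trans f4
  -- Every monomial of the exact bound is at most n³t², and the coefficients add up to 3 + 8 + 32 +
  -- 9 + 2 + 1 + 17 = 72.
  linarith

/-! ### Correctness -/

lemma cyclicShift_cyclicShift {t : ℕ} (x : Fin t → Bool) (a b : ℤ) :
    cyclicShift (cyclicShift x a) b = cyclicShift x (a + b) := by
  funext r
  have ht : (0 : ℤ) < t := by have := r.isLt; omega
  simp only [cyclicShift]
  congr 2
  rw [Int.toNat_of_nonneg (Int.emod_nonneg _ ht.ne'), Int.emod_add_emod]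
  congr 1
  ring_nf

lemma cyclicShift_emod_add {t : ℕ} (x : Fin t → Bool) (a b : ℤ) :
    cyclicShift x (a % t + b) = cyclicShift x (a + b) := by
  funext r
  simp only [cyclicShift]
  congr 3
  rw [Int.emod_eq_emod_iff_emod_sub_eq_zero]
  have : (r : ℤ) + (a % t + b) - (r + (a + b)) = -(t * (a / t)) := by
    have := Int.emod_add_mul_ediv a t
    linarith
  rw [this]
  simp

/-- The code must resist arbitrary integer shifts, while the check runs only over 0 ≤ i < t. -/
lemma shiftTriple_emod {t : ℕ} (x : Fin t → Bool) (a : ℤ) :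
    shiftTriple x (a % t) = shiftTriple x a := by
  have h0 := cyclicShift_emod_add x a 0
  simp only [add_zero] at h0
  rw [shiftTriple, sub_eq_add_neg, cyclicShift_emod_add, cyclicShift_emod_add, h0]
  rfl

lemma cyclicShift_sup {t : ℕ} {ι : Type} (R : Finset ι) (f : ι → Fin t → Bool) (a : ℤ) :
    cyclicShift (R.sup f) a = R.sup fun j => cyclicShift (f j) a := by
  funext r
  simp only [cyclicShift, Finset.sup_apply]

/-- Shifting relabels positions and so commutes with OR. This reduces the condition on k columns to
conditions on pairs, which can be tested. -/
lemma slipped_sup {t : ℕ} {ι : Type} (R : Finset ι) (x : ι → Fin t → Bool) (s : ι → ℤ) :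
    slipped (R.sup fun j => cyclicShift (x j) (s j)) = R.sup fun j => shiftTriple (x j) (s j) := by
  simp only [slipped, cyclicShift_sup, cyclicShift_cyclicShift, ← Finset.sup_sup]
  rfl

lemma segWeight_mono {t : ℕ} {x y : Fin t → Bool} (h : x ≤ y) (a b : ℕ) :
    segWeight x a b ≤ segWeight y a b := by
  refine Finset.card_le_card fun r => ?_
  simp only [Finset.mem_filter, Finset.mem_univ, true_and]
  exact fun hr => ⟨hr.1, hr.2.1, h r hr.2.2⟩

lemma segWeight_mono_left {t : ℕ} (x : Fin t → Bool) {a a' : ℕ} (h : a ≤ a') (b : ℕ) :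
    segWeight x a' b ≤ segWeight x a b := by
  refine Finset.card_le_card fun r => ?_
  simp only [Finset.mem_filter, Finset.mem_univ, true_and]
  exact fun hr => ⟨h.trans hr.1, hr.2⟩

lemma segWeight_le_add {t : ℕ} (x : Fin t → Bool) (a m b : ℕ) :
    segWeight x a b ≤ segWeight x a m + segWeight x m b := by
  refine le_trans (Finset.card_le_card fun r => ?_) (Finset.card_union_le _ _)
  simp only [Finset.mem_filter, Finset.mem_univ, true_and, Finset.mem_union]
  rintro ⟨h1, h2, h3⟩
  rcases le_total (r : ℕ) m with h | h
  · exact Or.inl ⟨h1, h, h3⟩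
  · exact Or.inr ⟨h, h2, h3⟩

lemma segWeight_inf_sup_le {t : ℕ} {ι : Type} (R : Finset ι) (x : Fin t → Bool)
    (f : ι → Fin t → Bool) (a b : ℕ) :
    segWeight (x ⊓ R.sup f) a b ≤ ∑ j ∈ R, segWeight (x ⊓ f j) a b := by
  classical
  refine le_trans (Finset.card_le_card fun r => ?_) Finset.card_biUnion_le
  simp only [Finset.mem_filter, Finset.mem_univ, true_and, Finset.mem_biUnion, Pi.inf_apply,
    Finset.sup_apply]
  rintro ⟨h1, h2, h3⟩
  have h4 : x r = true ∧ (R.sup fun j => f j r) = true := by simpa using h3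
  obtain ⟨j, hj, hjr⟩ : ∃ j ∈ R, f j r = true := by
    by_contra! hcon
    have : (R.sup fun j => f j r) ≤ false :=
      Finset.sup_le fun j hj => by simp [hcon j hj]
    rw [h4.2] at this
    exact absurd this (by decide)
  exact ⟨j, hj, h1, h2, by simp [h4.1, hjr]⟩

lemma tau₂_lt {c ε α : ℝ} {n k : ℕ} (ht : 1 ≤ numRows c ε α n) :
    tau₂ c ε α n k < numRows c ε α n := by
  unfold tau₂
  omega

lemma isURSC_of_pairInequalities {n : ℕ} {c ε α : ℝ}
    {M : Fin (numRows c ε (α / 2) n) → Fin n → Bool} (hα : 0 < α) (hα1 : α ≤ 1)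
    (hn : 1 ≤ n) (hnt : n ≤ numRows c ε (α / 2) n)
    (h : ∀ k, 2 ≤ k → k ≤ n → ∀ j j' : Fin n, j ≠ j' → ∀ i : Fin (numRows c ε (α / 2) n),
      PairInequalities M (α / 2) k (tau₁ c n k) (tau₂ c ε (α / 2) n k) j j' ((i : ℕ) : ℤ)) :
    IsURSC M α (tau₂ c ε (α / 2)) := by
  refine ⟨hnt, hα, hα1, fun k _ _ => tau₂_lt (hn.trans hnt), ?_⟩
  rintro k hk hkn T hT j hj z ⟨s, rfl⟩
  set a := tau₁ c n k
  set b := tau₂ c ε (α / 2) n k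
  have ht0 : (0 : ℤ) < numRows c ε (α / 2) n := by omega
  have hcol : ∀ j' ∈ T.erase j,
      (segWeight (column M j ⊓ shiftTriple (column M j') (s j')) a b : ℝ) ≤
        (α / 2 * segWeight (column M j) a b - 1) / ((k : ℝ) - 1) := by
    intro j' hj'
    have h1 := Int.emod_nonneg (s j') ht0.ne'
    have h2 := Int.emod_lt_of_pos (s j') ht0
    have h3 := (h k hk hkn j j' (Finset.ne_of_mem_erase hj').symm
      ⟨(s j' % (numRows c ε (α / 2) n : ℤ)).toNat, by omega⟩).2
    simp only [Int.toNat_of_nonneg h1] at h3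
    rwa [shiftTriple_emod] at h3
  -- The weight inequality does not involve a second column but is tested only inside the loop over
  -- pairs; since k ≥ 2 such a column exists, and shift 0 serves.
  obtain ⟨j', hj'⟩ : (T.erase j).Nonempty := by
    rw [← Finset.card_pos, Finset.card_erase_of_mem hj]
    omega
  have hw := (h k hk hkn j j' (Finset.ne_of_mem_erase hj').symm ⟨0, by omega⟩).1
  rw [slipped_sup]
  have hk1 : (0 : ℝ) < (k : ℝ) - 1 := by
    have : (2 : ℝ) ≤ k := by exact_mod_cast hk
    linarith
  have hsum : (segWeight (column M j ⊓ (T.erase j).sup fun j' =>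
      shiftTriple (column M j') (s j')) a b : ℝ) ≤ α / 2 * segWeight (column M j) a b - 1 := by
    calc _ ≤ ((∑ j' ∈ T.erase j,
            segWeight (column M j ⊓ shiftTriple (column M j') (s j')) a b : ℕ) : ℝ) := by
          exact_mod_cast segWeight_inf_sup_le ..
      _ ≤ ∑ j' ∈ T.erase j, (α / 2 * segWeight (column M j) a b - 1) / ((k : ℝ) - 1) := by
          push_cast
          exact Finset.sum_le_sum hcol
      _ = _ := by
          rw [Finset.sum_const, Finset.card_erase_of_mem hj, hT, nsmul_eq_mul,
            Nat.cast_sub (by omega)]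
          push_cast
          field_simp
  have h1 : (segWeight (column M j ⊓ (T.erase j).sup fun j' =>
      shiftTriple (column M j') (s j')) 0 b : ℝ) ≤ segWeight (column M j) 0 a +
        segWeight (column M j ⊓ (T.erase j).sup fun j' =>
      shiftTriple (column M j') (s j')) a b := by
    exact_mod_cast (segWeight_le_add _ 0 a b).trans
      (Nat.add_le_add_right (segWeight_mono inf_le_left 0 a) _)
  have h2 : (segWeight (column M j) a b : ℝ) ≤ segWeight (column M j) 0 b := by
    exact_mod_cast segWeight_mono_left _ (Nat.zero_le a) b
  have h3 := mul_le_mul_of_nonneg_left h2 hα.le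
  linarith

/-! ### Deviation bounds for the random matrix -/

open MeasureTheory ProbabilityTheory Real

lemma prob_nonneg (n r : ℕ) : 0 ≤ prob n r := (prob_mem_unitInterval n r).1

lemma prob_le_one (n r : ℕ) : prob n r ≤ 1 := (prob_mem_unitInterval n r).2

/-- The entries of the random matrix are independent. -/
lemma integral_prod_entries {t n : ℕ} (F : Fin t → Fin n → Bool → ℝ) :
    ∫ M, ∏ r, ∏ m, F r m (M r m) ∂(randomMatrix t n) =
      ∏ r : Fin t, ∏ m, (prob n r * F r m true + (1 - prob n r) * F r m false) := by
  rw [randomMatrix, integral_fintype_prod_eq_prod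
    (f := fun (r : Fin t) (row : Fin n → Bool) => ∏ m, F r m (row m))]
  refine Finset.prod_congr rfl fun r _ => ?_
  rw [integral_fintype_prod_eq_prod (f := fun (m : Fin n) (b : Bool) => F r m b)]
  refine Finset.prod_congr rfl fun m _ => ?_
  rw [integral_bernoulliMeasure]
  rfl

lemma integral_prod_column {t n : ℕ} (j : Fin n) (f : Fin t → Bool → ℝ) :
    ∫ M, ∏ r, f r (M r j) ∂(randomMatrix t n) =
      ∏ r : Fin t, (prob n r * f r true + (1 - prob n r) * f r false) := by
  have h := integral_prod_entries (n := n)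
    fun (r : Fin t) m b => if m = j then f r b else 1
  simp only [Finset.prod_ite_eq', Finset.mem_univ, if_true] at h
  rw [h]
  refine Finset.prod_congr rfl fun r _ => ?_
  rw [Finset.prod_eq_single j]
  · simp
  · intro m _ hm
    simp [hm]
  · simp

lemma integral_prod_two_columns {t n : ℕ} {j j' : Fin n} (hj : j ≠ j')
    (f g : Fin t → Bool → ℝ) :
    ∫ M, (∏ r, f r (M r j)) * ∏ r, g r (M r j') ∂(randomMatrix t n) =
      (∏ r : Fin t, (prob n r * f r true + (1 - prob n r) * f r false)) *
        ∏ r : Fin t, (prob n r * g r true + (1 - prob n r) * g r false) := by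
  have h := integral_prod_entries (n := n)
    fun (r : Fin t) m b => (if m = j then f r b else 1) * (if m = j' then g r b else 1)
  simp only [Finset.prod_mul_distrib, Finset.prod_ite_eq', Finset.mem_univ, if_true] at h
  rw [h, ← Finset.prod_mul_distrib]
  refine Finset.prod_congr rfl fun r _ => ?_
  rw [← Finset.prod_subset (Finset.subset_univ {j, j'}), Finset.prod_pair hj]
  · simp [hj, hj.symm]
  · intro m _ hm
    simp only [Finset.mem_insert, Finset.mem_singleton, not_or] at hm
    simp [hm.1, hm.2]

/-! ### Exponential moments and Chernoff bounds. -/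

lemma exp_card_filter {ι : Type} (A : Finset ι) (P : ι → Prop) [DecidablePred P] (s : ℝ) :
    exp (s * ((A.filter P).card : ℝ)) = ∏ r ∈ A, if P r then exp s else 1 := by
  rw [Finset.prod_ite, Finset.prod_const_one, mul_one, Finset.prod_const, ← exp_nat_mul,
    mul_comm]

lemma prod_one_add_le_exp {ι : Type} (A : Finset ι) (y : ι → ℝ) (hy : ∀ r ∈ A, 0 ≤ 1 + y r) :
    ∏ r ∈ A, (1 + y r) ≤ exp (∑ r ∈ A, y r) := by
  rw [exp_sum]
  exact Finset.prod_le_prod hy fun r _ => by linarith [add_one_le_exp (y r)]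

lemma exp_one_sub_one_le_two : exp 1 - 1 ≤ 2 := by
  linarith [exp_one_lt_d9]

lemma integral_exp_column {t n : ℕ} (j : Fin n) (A : Finset (Fin t)) (s : ℝ) :
    ∫ M, exp (s * ((A.filter fun r => M r j = true).card : ℝ)) ∂(randomMatrix t n) =
      ∏ r ∈ A, (1 + (exp s - 1) * prob n r) := by
  have h := integral_prod_column j
    fun (r : Fin t) b => if r ∈ A then (if b = true then exp s else 1) else 1
  simp only [exp_card_filter]
  simp only [Finset.prod_ite_mem, Finset.univ_inter] at h
  rw [h, ← Finset.prod_subset (Finset.subset_univ A)]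
  · refine Finset.prod_congr rfl fun r hr => ?_
    simp [hr]
    ring
  · intro r _ hr
    simp [hr]

/-- Chernoff's bound with exponent parameter 1, where e - 1 is rounded up to 2. -/
lemma measureReal_le_column {t n : ℕ} (j : Fin n) (A : Finset (Fin t)) (x : ℝ) :
    (randomMatrix t n).real {M | x ≤ ((A.filter fun r => M r j = true).card : ℝ)} ≤
      exp (2 * ∑ r ∈ A, prob n r - x) := by
  refine (measure_ge_le_exp_mul_mgf (X := fun M : Fin t → Fin n → Bool =>
    ((A.filter fun r => M r j = true).card : ℝ)) x zero_le_one Integrable.of_finite).trans ?_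
  rw [mgf, integral_exp_column, show 2 * ∑ r ∈ A, prob n r - x = -1 * x + 2 * ∑ r ∈ A, prob n r
    by ring, exp_add]
  gcongr
  refine (prod_one_add_le_exp _ _ fun r _ => ?_).trans (exp_le_exp.2 ?_)
  · nlinarith [prob_nonneg n r, add_one_le_exp (1 : ℝ)]
  · rw [← Finset.mul_sum]
    gcongr
    · exact Finset.sum_nonneg fun r _ => prob_nonneg n r
    · exact exp_one_sub_one_le_two

/-- Chernoff's bound with parameter -1, where 1 - 1/e is rounded down to 5/8; anything above 1/2
leaves room for the choice x = half the mean. -/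
lemma measureReal_column_le {t n : ℕ} (j : Fin n) (A : Finset (Fin t)) (x : ℝ) :
    (randomMatrix t n).real {M | ((A.filter fun r => M r j = true).card : ℝ) ≤ x} ≤
      exp (x - 5 / 8 * ∑ r ∈ A, prob n r) := by
  refine (measure_le_le_exp_mul_mgf (t := -1) (X := fun M : Fin t → Fin n → Bool =>
    ((A.filter fun r => M r j = true).card : ℝ)) x (by norm_num) Integrable.of_finite).trans ?_
  have he : exp (-1) ≤ 3 / 8 := by
    rw [exp_neg, inv_le_comm₀ (exp_pos 1) (by norm_num)]
    linarith [exp_one_gt_d9]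
  rw [mgf, integral_exp_column, show x - 5 / 8 * ∑ r ∈ A, prob n r =
    - -1 * x + -(5 / 8 * ∑ r ∈ A, prob n r) by ring, exp_add]
  gcongr
  refine (prod_one_add_le_exp _ _ fun r _ => ?_).trans (exp_le_exp.2 ?_)
  · nlinarith [prob_nonneg n r, prob_le_one n r, exp_pos (-1)]
  · rw [← Finset.mul_sum, ← neg_mul]
    gcongr
    · exact Finset.sum_nonneg fun r _ => prob_nonneg n r
    · linarith

/-- The entries (r, j) and (σ r, j') with r in B are pairwise distinct, since the columns differ and
σ is injective; hence they are independent. -/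
lemma integral_collision_pattern {t n : ℕ} {j j' : Fin n} (hj : j ≠ j') {σ : Fin t → Fin t}
    (hσ : Function.Injective σ) (B : Finset (Fin t)) :
    ∫ M, ∏ r ∈ B, (if M r j = true ∧ M (σ r) j' = true then (1 : ℝ) else 0)
        ∂(randomMatrix t n) = ∏ r ∈ B, prob n r * prob n (σ r) := by
  classical
  have h := integral_prod_two_columns hj
    (fun (r : Fin t) b => if r ∈ B then (if b = true then (1 : ℝ) else 0) else 1)
    (fun (r : Fin t) b => if r ∈ B.image σ then (if b = true then (1 : ℝ) else 0) else 1)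
  have key : ∀ (C : Finset (Fin t)), ∏ r : Fin t,
      (prob n r * (if r ∈ C then (if true = true then (1 : ℝ) else 0) else 1) +
        (1 - prob n r) * (if r ∈ C then (if false = true then (1 : ℝ) else 0) else 1)) =
      ∏ r ∈ C, prob n r := by
    intro C
    rw [← Finset.prod_subset (Finset.subset_univ C)]
    · exact Finset.prod_congr rfl fun r hr => by simp [hr]
    · intro r _ hr
      simp [hr]
  rw [key, key] at h
  simp only [Finset.prod_ite_mem, Finset.univ_inter] at h
  rw [Finset.prod_image hσ.injOn] at h
  simp only [Finset.prod_image hσ.injOn, ← Finset.prod_mul_distrib] at h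
  rw [← h]
  congr 1
  funext M
  refine Finset.prod_congr rfl fun r _ => ?_
  by_cases h1 : M r j = true <;> by_cases h2 : M (σ r) j' = true <;> simp [h1, h2]

/-- Expanding the product of 1 + (e^s - 1)·indicator over subsets B reduces the moment to the
collision patterns. -/
lemma integral_exp_collision {t n : ℕ} {j j' : Fin n} (hj : j ≠ j') {σ : Fin t → Fin t}
    (hσ : Function.Injective σ) (A : Finset (Fin t)) (s : ℝ) :
    ∫ M, exp (s * ((A.filter fun r => M r j = true ∧ M (σ r) j' = true).card : ℝ))
        ∂(randomMatrix t n) = ∏ r ∈ A, (1 + (exp s - 1) * (prob n r * prob n (σ r))) := by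
  have h : ∀ M : Fin t → Fin n → Bool,
      exp (s * ((A.filter fun r => M r j = true ∧ M (σ r) j' = true).card : ℝ)) =
      ∑ B ∈ A.powerset, (exp s - 1) ^ B.card *
        ∏ r ∈ B, (if M r j = true ∧ M (σ r) j' = true then (1 : ℝ) else 0) := by
    intro M
    simp only [← Finset.prod_const, ← Finset.prod_mul_distrib]
    rw [exp_card_filter, ← Finset.prod_one_add]
    refine Finset.prod_congr rfl fun r _ => ?_
    split_ifs <;> simp
  simp only [h]
  rw [integral_finsetSum _ fun _ _ => Integrable.of_finite, Finset.prod_one_add]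
  refine Finset.sum_congr rfl fun B _ => ?_
  rw [integral_const_mul, integral_collision_pattern hj hσ, ← Finset.prod_const,
    ← Finset.prod_mul_distrib]

lemma measureReal_le_collision {t n : ℕ} {j j' : Fin n} (hj : j ≠ j') {σ : Fin t → Fin t}
    (hσ : Function.Injective σ) (A : Finset (Fin t)) (x : ℝ) :
    (randomMatrix t n).real
      {M | x ≤ ((A.filter fun r => M r j = true ∧ M (σ r) j' = true).card : ℝ)} ≤
      exp (2 * ∑ r ∈ A, prob n r * prob n (σ r) - x) := by
  refine (measure_ge_le_exp_mul_mgf (X := fun M : Fin t → Fin n → Bool =>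
    ((A.filter fun r => M r j = true ∧ M (σ r) j' = true).card : ℝ)) x zero_le_one
    Integrable.of_finite).trans ?_
  rw [mgf, integral_exp_collision hj hσ, show 2 * ∑ r ∈ A, prob n r * prob n (σ r) - x =
    -1 * x + 2 * ∑ r ∈ A, prob n r * prob n (σ r) by ring, exp_add]
  have hp : ∀ r : Fin t, 0 ≤ prob n r * prob n (σ r) := fun r =>
    mul_nonneg (prob_nonneg n r) (prob_nonneg n _)
  gcongr
  refine (prod_one_add_le_exp _ _ fun r _ => ?_).trans (exp_le_exp.2 ?_)
  · nlinarith [hp r, add_one_le_exp (1 : ℝ)]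
  · rw [← Finset.mul_sum]
    gcongr
    · exact Finset.sum_nonneg fun r _ => hp r
    · exact exp_one_sub_one_le_two

/-- The position that `cyclicShift x i` reads at position `r`. -/
def rotate {t : ℕ} (i : ℤ) (r : Fin t) : Fin t :=
  ⟨(((r : ℤ) + i) % (t : ℤ)).toNat, by
    have ht : (0 : ℤ) < t := by have := r.isLt; omega
    have h1 := Int.emod_nonneg ((r : ℤ) + i) ht.ne'
    have h2 := Int.emod_lt_of_pos ((r : ℤ) + i) ht
    omega⟩

lemma cyclicShift_apply {t : ℕ} (x : Fin t → Bool) (i : ℤ) (r : Fin t) :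
    cyclicShift x i r = x (rotate i r) := rfl

lemma rotate_injective {t : ℕ} (i : ℤ) : Function.Injective (rotate i : Fin t → Fin t) := by
  intro r s h
  have ht : (0 : ℤ) < t := by have := r.isLt; omega
  have h1 := Int.emod_nonneg ((r : ℤ) + i) ht.ne'
  have h2 := Int.emod_nonneg ((s : ℤ) + i) ht.ne'
  have h3 : ((r : ℤ) + i) % t = ((s : ℤ) + i) % t := by
    have := congrArg Fin.val h
    simp only [rotate] at this
    omega
  have h4 : (r : ℤ) % t = (s : ℤ) % t := Int.ModEq.add_right_cancel' i h3
  rw [Int.emod_eq_of_lt (by omega) (by exact_mod_cast r.isLt),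
    Int.emod_eq_of_lt (by omega) (by exact_mod_cast s.isLt)] at h4
  exact Fin.ext (by exact_mod_cast h4)

/-- The row indices `a, …, b`. -/
def rows (t a b : ℕ) : Finset (Fin t) :=
  Finset.univ.filter fun r => a ≤ (r : ℕ) ∧ (r : ℕ) ≤ b

lemma segWeight_column {t n : ℕ} (M : Fin t → Fin n → Bool) (j : Fin n) (a b : ℕ) :
    segWeight (column M j) a b = ((rows t a b).filter fun r => M r j = true).card := by
  rw [rows, Finset.filter_filter, segWeight]
  simp only [and_assoc]
  rfl

lemma segWeight_collision {t n : ℕ} (M : Fin t → Fin n → Bool) (j j' : Fin n) (i : ℤ)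
    (a b : ℕ) :
    segWeight (column M j ⊓ cyclicShift (column M j') i) a b =
      ((rows t a b).filter fun r => M r j = true ∧ M (rotate i r) j' = true).card := by
  rw [rows, Finset.filter_filter, segWeight]
  congr 1
  ext r
  simp [cyclicShift_apply, column, and_assoc]

lemma segWeight_shiftTriple_le {t : ℕ} (x y : Fin t → Bool) (i : ℤ) (a b : ℕ) :
    segWeight (x ⊓ shiftTriple y i) a b ≤ segWeight (x ⊓ cyclicShift y (i - 1)) a b +
      segWeight (x ⊓ cyclicShift y i) a b + segWeight (x ⊓ cyclicShift y (i + 1)) a b := by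
  have h := segWeight_inf_sup_le {i - 1, i, i + 1} x (cyclicShift y) a b
  have h1 : i - 1 ∉ ({i, i + 1} : Finset ℤ) := by simp; omega
  have h2 : i ∉ ({i + 1} : Finset ℤ) := by simp
  rw [Finset.sum_insert h1, Finset.sum_insert h2, Finset.sum_singleton, Finset.sup_insert,
    Finset.sup_insert, Finset.sup_singleton, ← sup_assoc, ← add_assoc] at h
  exact h

/-! ### Failure of one test, and the union bound over all tests. -/

/-- The probability that one test fails, in terms of the expected weights. -/
lemma measureReal_not_pairInequalities_le {t n : ℕ} {α G : ℝ} {k a b : ℕ} {j j' : Fin n}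
    (hj : j ≠ j') (i : ℤ) (hα : 0 < α) (hα1 : α ≤ 1) (hk : 2 ≤ k) (hG : 10 / 9 ≤ G)
    (h1 : ∑ r ∈ rows t 0 a, prob n r ≤ 3 / 10 * (k * G))
    (h2 : 9 / 5 * (k * G) ≤ α * ∑ r ∈ rows t a b, prob n r)
    (h3 : ∀ s : ℤ, ∑ r ∈ rows t a b, prob n r * prob n (rotate s r) ≤ G / 20) :
    (randomMatrix t n).real {M | ¬ PairInequalities M α k a b j j' i} ≤
      5 * exp (-(G / 5)) := by
  have hk2 : (2 : ℝ) ≤ k := by exact_mod_cast hk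
  have hkG : 2 * G ≤ k * G := by nlinarith
  set m := ∑ r ∈ rows t a b, prob n r
  have hm : 9 / 5 * (k * G) ≤ m := by
    have : 0 ≤ m := Finset.sum_nonneg fun r _ => prob_nonneg n r
    nlinarith
  -- The Chernoff exponents are (6/10 - 9/10)kG, -m/8 and (1/10 - 3/10)G. The last one is -G/5, the
  -- weakest of the three.
  let E₁ : Set (Fin t → Fin n → Bool) :=
    {M | 9 / 10 * (k * G) ≤ (((rows t 0 a).filter fun r => M r j = true).card : ℝ)}
  let E₂ : Set (Fin t → Fin n → Bool) :=
    {M | (((rows t a b).filter fun r => M r j = true).card : ℝ) ≤ m / 2}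
  let E₃ : ℤ → Set (Fin t → Fin n → Bool) := fun s =>
    {M | 3 / 10 * G ≤
      (((rows t a b).filter fun r => M r j = true ∧ M (rotate s r) j' = true).card : ℝ)}
  have hE₁ : (randomMatrix t n).real E₁ ≤ exp (-(G / 5)) :=
    (measureReal_le_column ..).trans (exp_le_exp.2 (by linarith))
  have hE₂ : (randomMatrix t n).real E₂ ≤ exp (-(G / 5)) :=
    (measureReal_column_le ..).trans (exp_le_exp.2 (by linarith))
  have hE₃ : ∀ s, (randomMatrix t n).real (E₃ s) ≤ exp (-(G / 5)) := fun s =>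
    (measureReal_le_collision hj (rotate_injective s) ..).trans
      (exp_le_exp.2 (by linarith [h3 s]))
  have hsub : {M | ¬ PairInequalities M α k a b j j' i} ⊆
      E₁ ∪ E₂ ∪ (E₃ (i - 1) ∪ E₃ i ∪ E₃ (i + 1)) := by
    intro M hM
    by_contra hcon
    simp only [Set.mem_union, not_or, E₁, E₂, E₃, Set.mem_ofPred_eq, not_le] at hcon
    obtain ⟨⟨c1, c2⟩, ⟨c3, c4⟩, c5⟩ := hcon
    rw [← segWeight_column] at c1 c2
    rw [← segWeight_collision] at c3 c4 c5
    refine hM ?_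
    have hW : 9 / 10 * (k * G) ≤ α * segWeight (column M j) a b := by
      nlinarith [mul_le_mul_of_nonneg_left c2.le hα.le]
    refine ⟨c1.le.trans hW, ?_⟩
    have h4 : (segWeight (column M j ⊓ shiftTriple (column M j') i) a b : ℝ) ≤
        segWeight (column M j ⊓ cyclicShift (column M j') (i - 1)) a b +
        segWeight (column M j ⊓ cyclicShift (column M j') i) a b +
        segWeight (column M j ⊓ cyclicShift (column M j') (i + 1)) a b := by
      exact_mod_cast segWeight_shiftTriple_le _ _ i a b
    -- Three shifts give at most 3 · (3/10)G collisions. Then (9/10)G(k - 1) ≤ (9/10)kG - 1 amounts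
    -- to G ≥ 10/9.
    rw [le_div_iff₀ (by linarith)]
    have h5 : (segWeight (column M j ⊓ shiftTriple (column M j') i) a b : ℝ) ≤ 9 / 10 * G := by
      linarith
    nlinarith [mul_le_mul_of_nonneg_right h5 (by linarith : (0 : ℝ) ≤ k - 1)]
  refine (measureReal_mono hsub (measure_ne_top _ _)).trans ?_
  have u1 := measureReal_union_le (μ := randomMatrix t n) (E₁ ∪ E₂)
    (E₃ (i - 1) ∪ E₃ i ∪ E₃ (i + 1))
  have u2 := measureReal_union_le (μ := randomMatrix t n) E₁ E₂
  have u3 := measureReal_union_le (μ := randomMatrix t n) (E₃ (i - 1) ∪ E₃ i) (E₃ (i + 1))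
  have u4 := measureReal_union_le (μ := randomMatrix t n) (E₃ (i - 1)) (E₃ i)
  linarith [hE₃ (i - 1), hE₃ i, hE₃ (i + 1)]

lemma measureReal_check_fails_le {n : ℕ} {c ε α G : ℝ} (hα : 0 < α) (hα1 : α ≤ 1)
    (hG : 10 / 9 ≤ G)
    (h1 : ∀ k, 2 ≤ k → k ≤ n →
      ∑ r ∈ rows (numRows c ε α n) 0 (tau₁ c n k), prob n r ≤ 3 / 10 * (k * G))
    (h2 : ∀ k, 2 ≤ k → k ≤ n → 9 / 5 * (k * G) ≤
      α * ∑ r ∈ rows (numRows c ε α n) (tau₁ c n k) (tau₂ c ε α n k), prob n r)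
    (h3 : ∀ k, 2 ≤ k → k ≤ n → ∀ s : ℤ,
      ∑ r ∈ rows (numRows c ε α n) (tau₁ c n k) (tau₂ c ε α n k),
        prob n r * prob n (rotate s r) ≤ G / 20) :
    (randomMatrix (numRows c ε α n) n).real {M | ¬ (check c ε α M).val = true} ≤
      5 * n ^ 3 * numRows c ε α n * exp (-(G / 5)) := by
  classical
  set t := numRows c ε α n with ht
  let I : Finset (ℕ × Fin n × Fin n × Fin t) :=
    (Finset.Icc 2 n ×ˢ Finset.univ).filter fun q => q.2.1 ≠ q.2.2.1
  have hsub : {M | ¬ (check c ε α M).val = true} ⊆ ⋃ q ∈ I,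
      {M | ¬ PairInequalities M α q.1 (tau₁ c n q.1) (tau₂ c ε α n q.1) q.2.1 q.2.2.1
        ((q.2.2.2 : ℕ) : ℤ)} := by
    intro M hM
    rw [Set.mem_ofPred_eq, check_val] at hM
    push Not at hM
    obtain ⟨k, hk, hkn, j, j', hj, i, hi⟩ := hM
    simp only [Set.mem_iUnion]
    exact ⟨(k, j, j', i), by simp [I, hk, hkn, hj], hi⟩
  refine (measureReal_mono hsub (measure_ne_top _ _)).trans
    ((measureReal_biUnion_finset_le _ _).trans ?_)
  refine (Finset.sum_le_card_nsmul _ _ (5 * exp (-(G / 5))) fun q hq => ?_).trans ?_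
  · simp only [I, Finset.mem_filter, Finset.mem_product, Finset.mem_Icc, Finset.mem_univ,
      and_true] at hq
    obtain ⟨⟨hk, hkn⟩, hj⟩ := hq
    exact measureReal_not_pairInequalities_le hj _ hα hα1 hk hG (h1 _ hk hkn) (h2 _ hk hkn)
      (h3 _ hk hkn)
  · have hI : I.card ≤ n ^ 3 * t := by
      refine (Finset.card_filter_le _ _).trans ?_
      simp only [Finset.card_product, Nat.card_Icc, Finset.card_univ, Fintype.card_prod,
        Fintype.card_fin]
      calc (n + 1 - 2) * (n * (n * t)) ≤ n * (n * (n * t)) :=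
            Nat.mul_le_mul_right _ (by omega)
        _ = n ^ 3 * t := by ring
    have hI' : (I.card : ℝ) ≤ (n : ℝ) ^ 3 * t := by exact_mod_cast hI
    rw [nsmul_eq_mul]
    nlinarith [exp_pos (-(G / 5))]

/-! ### Estimates of the expected weights -/

lemma log_natCast_ge {n : ℕ} (hn : 2 ≤ n) : 69 / 100 ≤ log n := by
  have h : log 2 ≤ log n := log_le_log (by norm_num) (by exact_mod_cast hn)
  linarith [log_two_gt_d9]

lemma prob_antitone (n : ℕ) : Antitone (prob n) := by
  intro r s hrs
  refine sqrt_le_sqrt (one_div_le_one_div_of_le (by positivity) ?_)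
  have : ⌊(r : ℝ) / log n⌋₊ ≤ ⌊(s : ℝ) / log n⌋₊ := by
    gcongr
  have h : (⌊(r : ℝ) / log n⌋₊ : ℝ) ≤ ⌊(s : ℝ) / log n⌋₊ := by exact_mod_cast this
  linarith

lemma prob_le_sqrt {n r : ℕ} (hn : 2 ≤ n) (hr : 1 ≤ r) : prob n r ≤ √(log n / r) := by
  have hL := log_natCast_ge hn
  have hr' : (0 : ℝ) < r := by exact_mod_cast hr
  refine sqrt_le_sqrt ?_
  rw [← one_div_div (r : ℝ)]
  exact one_div_le_one_div_of_le (div_pos hr' (by linarith)) (Nat.lt_floor_add_one _).le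

lemma sqrt_le_prob {n : ℕ} (hn : 2 ≤ n) (r : ℕ) : √(log n / (r + log n)) ≤ prob n r := by
  have hL := log_natCast_ge hn
  have hL' : 0 < log n := by linarith
  refine sqrt_le_sqrt ?_
  rw [← one_div_div (r + log n : ℝ)]
  refine one_div_le_one_div_of_le (add_pos_of_nonneg_of_pos (Nat.cast_nonneg _) one_pos) ?_
  rw [add_div, div_self hL'.ne']
  gcongr
  exact Nat.floor_le (by positivity)

lemma sum_rows_le {t : ℕ} (f : ℕ → ℝ) (hf : ∀ r, 0 ≤ f r) (a b : ℕ) :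
    ∑ r ∈ rows t a b, f r ≤ ∑ r ∈ Finset.Icc a b, f r := by
  rw [← Finset.sum_image (f := f) (g := fun r : Fin t => (r : ℕ)) Fin.val_injective.injOn]
  refine Finset.sum_le_sum_of_subset_of_nonneg (fun r hr => ?_) fun _ _ _ => hf _
  simp only [rows, Finset.mem_image, Finset.mem_filter, Finset.mem_univ, true_and] at hr
  obtain ⟨s, hs, rfl⟩ := hr
  exact Finset.mem_Icc.2 hs

/-- Lower bounds on expected weights need the whole segment to lie inside the matrix; this is where
the cap of τ₂ at t - 1 enters. -/
lemma sum_rows_eq {t : ℕ} (f : ℕ → ℝ) {a b : ℕ} (hb : b < t) :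
    ∑ r ∈ rows t a b, f r = ∑ r ∈ Finset.Icc a b, f r := by
  rw [← Finset.sum_image (f := f) (g := fun r : Fin t => (r : ℕ)) Fin.val_injective.injOn]
  congr 1
  ext r
  simp only [rows, Finset.mem_image, Finset.mem_filter, Finset.mem_univ, true_and,
    Finset.mem_Icc]
  constructor
  · rintro ⟨s, hs, rfl⟩
    exact hs
  · intro hr
    exact ⟨⟨r, by omega⟩, hr, rfl⟩

lemma sum_prob_le {n : ℕ} (hn : 2 ≤ n) (m : ℕ) :
    ∑ r ∈ Finset.Icc 0 m, prob n r ≤ 1 + 2 * (√(log n) * √m) := by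
  induction m with
  | zero => simpa using prob_le_one n 0
  | succ m ih =>
    rw [Finset.sum_Icc_succ_top (Nat.zero_le _)]
    have h := prob_le_sqrt hn (Nat.le_add_left 1 m)
    rw [sqrt_div' _ (by positivity)] at h
    -- Telescoping comparison with the integral of 1/√x; row 0 is bounded separately by 1.
    have h1 : 1 / √((m + 1 : ℕ) : ℝ) ≤ 2 * (√((m + 1 : ℕ) : ℝ) - √m) := by
      have hp : 0 < √((m + 1 : ℕ) : ℝ) := sqrt_pos.2 (by positivity)
      have e1 : √((m + 1 : ℕ) : ℝ) ^ 2 = m + 1 := by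
        rw [sq_sqrt (by positivity)]
        push_cast
        ring
      have e2 : √(m : ℝ) ^ 2 = m := sq_sqrt (by positivity)
      rw [div_le_iff₀ hp]
      nlinarith [sq_nonneg (√((m + 1 : ℕ) : ℝ) - √m)]
    have h2 : √(log n) / √((m + 1 : ℕ) : ℝ) ≤
        √(log n) * (2 * (√((m + 1 : ℕ) : ℝ) - √m)) := by
      rw [div_eq_mul_one_div]
      exact mul_le_mul_of_nonneg_left h1 (sqrt_nonneg _)
    linarith

lemma le_sum_prob {n : ℕ} (hn : 2 ≤ n) {a b : ℕ} (hab : a ≤ b) :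
    2 * √(log n) * (√(b + 1 + log n) - √(a + log n)) ≤ ∑ r ∈ Finset.Icc a b, prob n r := by
  have hL := log_natCast_ge hn
  -- The floor in the row probability shifts the argument by at most ln n, so the telescoping runs
  -- over √(r + ln n).
  have term : ∀ r : ℕ, 2 * √(log n) * (√(r + 1 + log n) - √(r + log n)) ≤ prob n r := by
    intro r
    refine le_trans ?_ (sqrt_le_prob hn r)
    have hp : 0 < √(r + log n) := sqrt_pos.2 (by positivity)
    have e1 : √(r + 1 + log n) ^ 2 = r + 1 + log n := sq_sqrt (by positivity)
    have e2 : √(r + log n) ^ 2 = r + log n := sq_sqrt (by positivity)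
    rw [sqrt_div' _ (by positivity), le_div_iff₀ hp]
    have h : 2 * (√(r + 1 + log n) - √(r + log n)) * √(r + log n) ≤ 1 := by
      nlinarith [sq_nonneg (√(r + 1 + log n) - √(r + log n))]
    nlinarith [mul_le_mul_of_nonneg_left h (sqrt_nonneg (log n))]
  induction b, hab using Nat.le_induction with
  | base => simpa using term a
  | succ b hab ih =>
    rw [Finset.sum_Icc_succ_top (by omega)]
    have := term (b + 1)
    push_cast at this ⊢
    linarith

lemma sum_prob_sq_le {n : ℕ} (hn : 2 ≤ n) {a b : ℕ} (ha : 1 ≤ a) (hab : a ≤ b) :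
    ∑ r ∈ Finset.Icc a b, prob n r ^ 2 ≤ log n * (1 + log ((b : ℝ) / a)) := by
  have hL := log_natCast_ge hn
  have ha' : (1 : ℝ) ≤ a := by exact_mod_cast ha
  have term : ∀ r : ℕ, 1 ≤ r → prob n r ^ 2 ≤ log n / r := fun r hr => by
    have h := pow_le_pow_left₀ (prob_nonneg n r) (prob_le_sqrt hn hr) 2
    rwa [sq_sqrt (by positivity)] at h
  induction b, hab using Nat.le_induction with
  | base =>
    rw [Finset.Icc_self, Finset.sum_singleton, div_self (by positivity), log_one, add_zero,
      mul_one]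
    refine (term a ha).trans (div_le_self (by linarith) ha')
  | succ b hab ih =>
    rw [Finset.sum_Icc_succ_top (by omega)]
    have h1 := term (b + 1) (by omega)
    have hb : (0 : ℝ) < b := by
      have : 0 < b := by omega
      exact_mod_cast this
    have h2 : 1 / ((b + 1 : ℕ) : ℝ) ≤ log ((b + 1 : ℕ) / (b : ℝ)) := by
      have := one_sub_inv_le_log_of_pos (x := ((b + 1 : ℕ) : ℝ) / b) (by positivity)
      refine le_trans (le_of_eq ?_) this
      push_cast
      field_simp
      ring
    have h3 : log (((b + 1 : ℕ) : ℝ) / a) = log ((b : ℝ) / a) + log ((b + 1 : ℕ) / (b : ℝ)) := by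
      rw [← log_mul (by positivity) (by positivity)]
      congr 1
      field_simp
    rw [h3]
    have h4 : log n / ((b + 1 : ℕ) : ℝ) ≤ log n * log ((b + 1 : ℕ) / (b : ℝ)) := by
      rw [div_eq_mul_one_div]
      exact mul_le_mul_of_nonneg_left h2 (by linarith)
    linarith

lemma sum_comp_le_sum_rows {t : ℕ} {σ : Fin t → Fin t} (hσ : Function.Injective σ)
    (A : Finset (Fin t)) (f : ℕ → ℝ) (hf : ∀ r, 0 ≤ f r) (a b : ℕ) :
    ∑ r ∈ A, (if σ r ∈ rows t a b then f (σ r) else 0) ≤ ∑ r ∈ Finset.Icc a b, f r := by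
  classical
  refine le_trans ?_ (sum_rows_le (t := t) f hf a b)
  rw [← Finset.sum_image (f := fun s : Fin t => if s ∈ rows t a b then f s else 0) hσ.injOn,
    ← Finset.sum_filter]
  exact Finset.sum_le_sum_of_subset_of_nonneg (fun r hr => (Finset.mem_filter.1 hr).2)
    fun _ _ _ => hf _

/-- Row probabilities decrease, so a product is at most the square at the smaller of the two
positions. If σ r ≥ r this is the square at r; if a < σ r ≤ r it is the square at σ r, still inside
the segment. If σ r ≤ a, the factor at r is at most the one at a, which gives the last term.
Injectivity of σ makes each position count at most once. -/
lemma sum_prob_mul_prob_comp_le {t : ℕ} (n : ℕ) {σ : Fin t → Fin t} (hσ : Function.Injective σ)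
    (a b : ℕ) :
    ∑ r ∈ rows t a b, prob n r * prob n (σ r) ≤
      2 * ∑ r ∈ Finset.Icc a b, prob n r ^ 2 +
        prob n a * ∑ r ∈ Finset.Icc 0 a, prob n r := by
  classical
  have h1 := sum_rows_le (t := t) (fun r => prob n r ^ 2) (fun r => sq_nonneg _) a b
  have h2 := sum_comp_le_sum_rows hσ (rows t a b) (fun r => prob n r ^ 2)
    (fun r => sq_nonneg _) a b
  have h3 := sum_comp_le_sum_rows hσ (rows t a b) (prob n) (prob_nonneg n) 0 a
  have h4 := mul_le_mul_of_nonneg_left h3 (prob_nonneg n a)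
  have key : ∑ r ∈ rows t a b, prob n r * prob n (σ r) ≤
      ∑ r ∈ rows t a b, (prob n r ^ 2 + (if σ r ∈ rows t a b then prob n (σ r) ^ 2 else 0) +
        prob n a * (if σ r ∈ rows t 0 a then prob n (σ r) else 0)) := by
    refine Finset.sum_le_sum fun r hr => ?_
    simp only [rows, Finset.mem_filter, Finset.mem_univ, true_and] at hr
    have p1 := prob_nonneg n r
    have p2 := prob_nonneg n (σ r)
    have p3 : prob n r ≤ prob n a := prob_antitone n hr.1
    have n1 : 0 ≤ (if σ r ∈ rows t a b then prob n (σ r) ^ 2 else 0) := by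
      split_ifs <;> positivity
    have n2 : 0 ≤ prob n a * (if σ r ∈ rows t 0 a then prob n (σ r) else 0) := by
      have := prob_nonneg n a
      split_ifs <;> positivity
    by_cases c1 : (σ r : ℕ) ≤ a
    · have hmem : σ r ∈ rows t 0 a := by simp [rows, c1]
      rw [if_pos hmem]
      nlinarith [mul_le_mul_of_nonneg_right p3 p2]
    · rcases le_total (r : ℕ) (σ r) with c2 | c2
      · have := prob_antitone n c2
        nlinarith
      · have hmem : σ r ∈ rows t a b := by
          simp only [rows, Finset.mem_filter, Finset.mem_univ, true_and]
          omega
        have := prob_antitone n c2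
        rw [if_pos hmem] at n1 ⊢
        nlinarith
  rw [Finset.sum_add_distrib, Finset.sum_add_distrib, ← Finset.mul_sum] at key
  linarith

/-! ### The choice of the parameters -/

/-- The threshold for `√c` from which the failure probability is small. -/
def threshold (ε : ℝ) : ℝ := 8192 + 160 / ε

lemma threshold_pos (hε : 0 < ε) : 0 < threshold ε := by
  unfold threshold
  positivity

/-- The scale `√c · α ^ (-ε / 2) · ln n` of the exponents. -/
def scale (c ε α : ℝ) (n : ℕ) : ℝ := √c * log n * (1 / α) ^ (ε / 2)

/-- As a perfect square, the length factor has an explicit root when √τ₂ is estimated. -/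
lemma one_div_rpow_eq {ε α : ℝ} (hα : 0 < α) :
    1 / α ^ (2 + ε) = (1 / α * (1 / α) ^ (ε / 2)) ^ 2 := by
  have h : (0 : ℝ) < 1 / α := by positivity
  rw [mul_pow, ← rpow_natCast ((1 / α) ^ (ε / 2)), ← rpow_mul h.le, ← rpow_natCast (1 / α),
    ← rpow_add h, one_div, one_div, inv_rpow hα.le]
  congr 2
  push_cast
  ring

lemma one_le_one_div_rpow {ε α : ℝ} (hε : 0 < ε) (hα : 0 < α) (hα1 : α ≤ 1) :
    1 ≤ (1 / α) ^ (ε / 2) :=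
  Real.one_le_rpow (one_le_one_div hα hα1) (by positivity)

/-- The only use of the extra ε: a logarithm of 1/α is paid for by a small power, at the price 2/ε.
-/
lemma log_one_div_le {ε α : ℝ} (hε : 0 < ε) (hα : 0 < α) :
    log (1 / α) ≤ 2 / ε * (1 / α) ^ (ε / 2) := by
  refine (log_le_rpow_div (by positivity) (by positivity : 0 < ε / 2)).trans_eq ?_
  field_simp

/-- The conditions on the parameters. -/
structure Admissible (c ε α : ℝ) (n : ℕ) : Prop where
  two_le : 2 ≤ n
  eps_pos : 0 < ε
  alpha_pos : 0 < α
  alpha_le_half : α ≤ 1 / 2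
  threshold_sq_le : threshold ε ^ 2 ≤ c

namespace Admissible

variable {c ε α : ℝ} {n : ℕ}

lemma c_pos (h : Admissible c ε α n) : 0 < c :=
  (pow_pos (threshold_pos h.eps_pos) 2).trans_le h.threshold_sq_le

lemma threshold_le_sqrt (h : Admissible c ε α n) : threshold ε ≤ √c :=
  le_sqrt_of_sq_le h.threshold_sq_le

lemma le_sqrt (h : Admissible c ε α n) : 8192 ≤ √c := by
  have h1 := h.threshold_le_sqrt
  have h2 : 0 ≤ 160 / ε := by have := h.eps_pos; positivity
  unfold threshold at h1
  linarith

lemma one_le_rpow (h : Admissible c ε α n) : 1 ≤ (1 / α) ^ (ε / 2) :=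
  one_le_one_div_rpow h.eps_pos h.alpha_pos (by linarith [h.alpha_le_half])

lemma two_le_one_div (h : Admissible c ε α n) : 2 ≤ 1 / α := by
  rw [le_div_iff₀ h.alpha_pos]
  linarith [h.alpha_le_half]

lemma le_log (h : Admissible c ε α n) : 69 / 100 ≤ log n := log_natCast_ge h.two_le

lemma le_scale (h : Admissible c ε α n) : 8192 * (69 / 100) ≤ scale c ε α n := by
  have h1 := h.le_sqrt
  have h2 := h.le_log
  have h3 := h.one_le_rpow
  unfold scale
  have h4 : 8192 * (69 / 100) ≤ √c * log n := by gcongr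
  nlinarith

/-! ### Sizes of t, τ₁ and τ₂. -/

lemma div_rpow_eq (h : Admissible c ε α n) :
    c / α ^ (2 + ε) = (√c * (1 / α * (1 / α) ^ (ε / 2))) ^ 2 := by
  rw [mul_pow, ← one_div_rpow_eq h.alpha_pos, sq_sqrt h.c_pos.le, mul_one_div]

lemma numRows_ge (h : Admissible c ε α n) :
    (√c * (1 / α * (1 / α) ^ (ε / 2))) ^ 2 * (n : ℝ) ^ 2 * log n ≤ numRows c ε α n := by
  rw [← h.div_rpow_eq]
  exact Nat.le_ceil _

lemma numRows_le (h : Admissible c ε α n) :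
    (numRows c ε α n : ℝ) ≤ 2 * (√c * (1 / α * (1 / α) ^ (ε / 2))) ^ 2 * (n : ℝ) ^ 3 := by
  have h1 := h.le_sqrt
  have h2 := h.le_log
  have h3 := h.one_le_rpow
  have h4 := h.two_le_one_div
  have hn : (2 : ℝ) ≤ n := by exact_mod_cast h.two_le
  have h5 : 1 ≤ √c * (1 / α * (1 / α) ^ (ε / 2)) :=
    one_le_mul_of_one_le_of_one_le (by linarith)
      (one_le_mul_of_one_le_of_one_le (by linarith) h3)
  have h6 := Nat.ceil_lt_add_one
    (a := (√c * (1 / α * (1 / α) ^ (ε / 2))) ^ 2 * (n : ℝ) ^ 2 * log n) (by positivity)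
  have h7 : log n ≤ n := log_le_self (by positivity)
  rw [numRows, h.div_rpow_eq]
  have h8 : 1 ≤ (√c * (1 / α * (1 / α) ^ (ε / 2))) ^ 2 * (n : ℝ) ^ 3 :=
    one_le_mul_of_one_le_of_one_le (one_le_pow₀ h5) (one_le_pow₀ (by linarith))
  have h9 : (√c * (1 / α * (1 / α) ^ (ε / 2))) ^ 2 * (n : ℝ) ^ 2 * log n ≤
      (√c * (1 / α * (1 / α) ^ (ε / 2))) ^ 2 * (n : ℝ) ^ 2 * n := by gcongr
  nlinarith

lemma le_numRows (h : Admissible c ε α n) : n ≤ numRows c ε α n := by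
  have h1 := h.le_sqrt
  have h2 := h.le_log
  have h3 := h.one_le_rpow
  have h4 := h.two_le_one_div
  have hn : (2 : ℝ) ≤ n := by exact_mod_cast h.two_le
  have h5 : 1 ≤ √c * (1 / α * (1 / α) ^ (ε / 2)) :=
    one_le_mul_of_one_le_of_one_le (by linarith)
      (one_le_mul_of_one_le_of_one_le (by linarith) h3)
  have h6 := h.numRows_ge
  have h7 : (1 : ℝ) ≤ (√c * (1 / α * (1 / α) ^ (ε / 2))) ^ 2 := one_le_pow₀ h5
  have h8 : (n : ℝ) ≤ numRows c ε α n := by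
    refine le_trans ?_ h6
    calc (n : ℝ) ≤ 1 * (n : ℝ) ^ 2 * (69 / 100) := by nlinarith
      _ ≤ _ := by gcongr
  exact_mod_cast h8

lemma tau₂_le (h : Admissible c ε α n) (k : ℕ) :
    (tau₂ c ε α n k : ℝ) ≤
      (√c * (1 / α * (1 / α) ^ (ε / 2))) ^ 2 * (k : ℝ) ^ 2 * log n := by
  have h1 : (tau₂ c ε α n k : ℝ) ≤ ⌊c * ((k : ℝ) ^ 2 / α ^ (2 + ε)) * log n⌋₊ :=
    Nat.cast_le.2 (min_le_left _ _)
  refine (h1.trans (Nat.floor_le ?_)).trans_eq ?_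
  · have := h.c_pos
    have := h.alpha_pos
    have := h.le_log
    positivity
  · rw [← h.div_rpow_eq]
    ring

lemma le_tau₂_add_one (h : Admissible c ε α n) {k : ℕ} (hk : k ≤ n) :
    (√c * (1 / α * (1 / α) ^ (ε / 2))) ^ 2 * (k : ℝ) ^ 2 * log n ≤
      (tau₂ c ε α n k : ℝ) + 1 := by
  have h1 : 0 < numRows c ε α n := lt_of_lt_of_le (by linarith [h.two_le]) h.le_numRows
  -- When the cap t - 1 is attained, t itself is large enough because k ≤ n.
  rcases min_choice ⌊c * ((k : ℝ) ^ 2 / α ^ (2 + ε)) * log n⌋₊ (numRows c ε α n - 1)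
    with h2 | h2
  · rw [tau₂, h2, ← h.div_rpow_eq]
    refine le_trans (le_of_eq ?_) (Nat.lt_floor_add_one _).le
    ring
  · rw [tau₂, h2, Nat.cast_sub h1, Nat.cast_one, sub_add_cancel]
    refine le_trans ?_ h.numRows_ge
    have := h.le_log
    gcongr

lemma tau₁_le (h : Admissible c ε α n) (k : ℕ) :
    (tau₁ c n k : ℝ) ≤ (√c * k / 8) ^ 2 * log n := by
  refine (Nat.floor_le ?_).trans_eq ?_
  · have := h.c_pos
    have := h.le_log
    positivity
  · rw [div_pow, mul_pow, sq_sqrt h.c_pos.le]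
    ring

lemma le_tau₁_add_one (h : Admissible c ε α n) (k : ℕ) :
    (√c * k / 8) ^ 2 * log n ≤ tau₁ c n k + 1 := by
  refine le_trans (le_of_eq ?_) (Nat.lt_floor_add_one _).le
  rw [div_pow, mul_pow, sq_sqrt h.c_pos.le]
  ring

lemma four_le_mul_log (h : Admissible c ε α n) {k : ℕ} (hk : 2 ≤ k) :
    4 ≤ (√c * k / 8) ^ 2 * log n := by
  have h1 := h.le_sqrt
  have h2 := h.le_log
  have hk' : (2 : ℝ) ≤ k := by exact_mod_cast hk
  have h3 : 8192 * 2 / 8 ≤ √c * k / 8 := by gcongr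
  calc (4 : ℝ) ≤ (8192 * 2 / 8) ^ 2 * (69 / 100) := by norm_num
    _ ≤ _ := by gcongr

lemma one_le_tau₁ (h : Admissible c ε α n) {k : ℕ} (hk : 2 ≤ k) : 1 ≤ tau₁ c n k := by
  have h1 := h.four_le_mul_log hk
  have h2 := h.le_tau₁_add_one k
  have h3 : (1 : ℝ) ≤ tau₁ c n k := by linarith
  exact_mod_cast h3

lemma tau₁_le_tau₂ (h : Admissible c ε α n) {k : ℕ} (hk : 2 ≤ k) (hkn : k ≤ n) :
    tau₁ c n k ≤ tau₂ c ε α n k := by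
  have h1 := h.tau₁_le k
  have h2 := h.le_tau₂_add_one hkn
  have h3 := h.four_le_mul_log hk
  have h4 : 2 * ((√c * k / 8) ^ 2 * log n) ≤
      (√c * (1 / α * (1 / α) ^ (ε / 2))) ^ 2 * (k : ℝ) ^ 2 * log n := by
    have e1 : 1 ≤ 1 / α * (1 / α) ^ (ε / 2) :=
      one_le_mul_of_one_le_of_one_le (by linarith [h.two_le_one_div]) h.one_le_rpow
    have e2 : √c * 1 ≤ √c * (1 / α * (1 / α) ^ (ε / 2)) := by gcongr
    have e3 := h.le_log
    calc 2 * ((√c * k / 8) ^ 2 * log n) = 1 / 32 * ((√c * 1) ^ 2 * (k : ℝ) ^ 2 * log n) := by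
          ring
      _ ≤ 1 * ((√c * 1) ^ 2 * (k : ℝ) ^ 2 * log n) := by gcongr; norm_num
      _ ≤ _ := by rw [one_mul]; gcongr
  have h5 : (tau₁ c n k : ℝ) ≤ tau₂ c ε α n k := by linarith
  exact_mod_cast h5

/-! ### Expected weights at the chosen parameters. -/

lemma sum_prob_top_le (h : Admissible c ε α n) {k : ℕ} (hk : 2 ≤ k) :
    ∑ r ∈ rows (numRows c ε α n) 0 (tau₁ c n k), prob n r ≤ 3 / 10 * (k * scale c ε α n) := by
  refine ((sum_rows_le (prob n) (prob_nonneg n) _ _).trans (sum_prob_le h.two_le _)).trans ?_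
  have hy := h.le_sqrt
  have hL := h.le_log
  have hB := h.one_le_rpow
  have hk' : (2 : ℝ) ≤ k := by exact_mod_cast hk
  have h1 : √(tau₁ c n k) ≤ √c * k / 8 * √(log n) := by
    rw [← sqrt_sq (by positivity : 0 ≤ √c * k / 8), ← sqrt_mul (by positivity)]
    exact sqrt_le_sqrt (h.tau₁_le k)
  have h2 : √(log n) * √(tau₁ c n k) ≤ √c * k / 8 * log n := by
    calc _ ≤ √(log n) * (√c * k / 8 * √(log n)) := by gcongr
      _ = √c * k / 8 * (√(log n) * √(log n)) := by ring
      _ = _ := by rw [mul_self_sqrt (by linarith)]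
  have h3 : 8192 * (69 / 100) * 2 ≤ √c * log n * k := by gcongr
  have h4 : √c * log n * k ≤ k * scale c ε α n := by
    unfold scale
    nlinarith
  linarith

lemma le_sum_prob_bottom (h : Admissible c ε α n) {k : ℕ} (hk : 2 ≤ k) (hkn : k ≤ n) :
    9 / 5 * (k * scale c ε α n) ≤
      α * ∑ r ∈ rows (numRows c ε α n) (tau₁ c n k) (tau₂ c ε α n k), prob n r := by
  have ht : 1 ≤ numRows c ε α n := le_trans (by linarith [h.two_le]) h.le_numRows
  rw [sum_rows_eq (prob n) (tau₂_lt ht)]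
  have hα := h.alpha_pos
  have hα2 := h.alpha_le_half
  refine le_trans ?_ (mul_le_mul_of_nonneg_left
    (le_sum_prob h.two_le (h.tau₁_le_tau₂ hk hkn)) hα.le)
  have hy := h.le_sqrt
  have hL := h.le_log
  have hB := h.one_le_rpow
  have hA := h.two_le_one_div
  have hk' : (2 : ℝ) ≤ k := by exact_mod_cast hk
  have h1 : √c * (1 / α * (1 / α) ^ (ε / 2)) * k * √(log n) ≤
      √(tau₂ c ε α n k + 1 + log n) := by
    refine Real.le_sqrt_of_sq_le ?_
    have := h.le_tau₂_add_one hkn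
    rw [mul_pow, sq_sqrt (by linarith), mul_pow]
    linarith
  have h2 : √(tau₁ c n k + log n) ≤ (√c * k / 8 + 1) * √(log n) := by
    refine sqrt_le_iff.2 ⟨by positivity, ?_⟩
    rw [mul_pow, sq_sqrt (by linarith)]
    have := h.tau₁_le k
    have : 0 ≤ √c * k / 8 * log n := by positivity
    nlinarith
  have h3 : √c * k * (1 / α * (1 / α) ^ (ε / 2)) - (√c * k / 8 + 1) ≤
      (√(tau₂ c ε α n k + 1 + log n) - √(tau₁ c n k + log n)) / √(log n) := by
    rw [le_div_iff₀ (sqrt_pos.2 (by linarith))]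
    linarith
  -- The 64 in τ₁ becomes 8 under the root. As α ≤ 1/2, removing the rows before τ₁ costs at most
  -- √c·k/16 + 1/2, less than a tenth of the main term.
  have h4 : 9 / 10 * (√c * k * (1 / α) ^ (ε / 2)) ≤
      α * (√c * k * (1 / α * (1 / α) ^ (ε / 2)) - (√c * k / 8 + 1)) := by
    have e1 : α * (√c * k * (1 / α * (1 / α) ^ (ε / 2))) = √c * k * (1 / α) ^ (ε / 2) := by
      field_simp
    have e2 : 8192 * 2 ≤ √c * k := by gcongr
    have e3 : √c * k ≤ √c * k * (1 / α) ^ (ε / 2) := le_mul_of_one_le_right (by positivity) hB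
    have e4 : α * (√c * k / 8 + 1) ≤ 1 / 2 * (√c * k / 8 + 1) := by gcongr
    rw [mul_sub, e1]
    linarith
  have h5 : 2 * √(log n) * (√(tau₂ c ε α n k + 1 + log n) - √(tau₁ c n k + log n)) =
      2 * log n *
        ((√(tau₂ c ε α n k + 1 + log n) - √(tau₁ c n k + log n)) / √(log n)) := by
    have hs : √(log n) ≠ 0 := (sqrt_pos.2 (by linarith)).ne'
    have : log n = √(log n) * √(log n) := (mul_self_sqrt (by linarith)).symm
    rw [eq_comm, mul_div_assoc', div_eq_iff hs]
    nth_rewrite 1 [this]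
    ring
  rw [h5]
  calc 9 / 5 * (k * scale c ε α n) = 2 * log n * (9 / 10 * (√c * k * (1 / α) ^ (ε / 2))) := by
        unfold scale
        ring
    _ ≤ 2 * log n * (α * (√c * k * (1 / α * (1 / α) ^ (ε / 2)) - (√c * k / 8 + 1))) := by
        gcongr
    _ ≤ 2 * log n * (α *
        ((√(tau₂ c ε α n k + 1 + log n) - √(tau₁ c n k + log n)) / √(log n))) := by gcongr
    _ = _ := by ring

lemma tau₂_div_tau₁_le (h : Admissible c ε α n) {k : ℕ} (hk : 2 ≤ k) :
    (tau₂ c ε α n k : ℝ) / tau₁ c n k ≤ 128 * (1 / α * (1 / α) ^ (ε / 2)) ^ 2 := by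
  have h1 := h.le_tau₁_add_one k
  have h2 := h.tau₂_le k
  have h3 := h.four_le_mul_log hk
  -- Rounding down costs at most a factor 2, whence 128 = 2 · 64 in the ratio.
  have h4 : (√c * k / 8) ^ 2 * log n / 2 ≤ tau₁ c n k := by linarith
  rw [div_le_iff₀ (by linarith)]
  calc (tau₂ c ε α n k : ℝ) ≤ _ := h2
    _ = 128 * (1 / α * (1 / α) ^ (ε / 2)) ^ 2 * ((√c * k / 8) ^ 2 * log n / 2) := by ring
    _ ≤ _ := by gcongr

lemma log_tau₂_div_tau₁_le (h : Admissible c ε α n) {k : ℕ} (hk : 2 ≤ k) (hkn : k ≤ n) :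
    log ((tau₂ c ε α n k : ℝ) / tau₁ c n k) ≤
      (7 + 4 / ε) * (1 / α) ^ (ε / 2) := by
  have hε := h.eps_pos
  have hα := h.alpha_pos
  have hB := h.one_le_rpow
  have h1 : (1 : ℝ) ≤ tau₁ c n k := by exact_mod_cast h.one_le_tau₁ hk
  have h2 : (tau₁ c n k : ℝ) ≤ tau₂ c ε α n k := by exact_mod_cast h.tau₁_le_tau₂ hk hkn
  have h3 : log (128 * (1 / α * (1 / α) ^ (ε / 2)) ^ 2) =
      7 * log 2 + (2 + ε) * log (1 / α) := by
    rw [log_mul (by norm_num) (by positivity), log_pow, log_mul (by positivity) (by positivity),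
      log_rpow (by positivity), show (128 : ℝ) = 2 ^ 7 by norm_num, log_pow]
    push_cast
    ring
  refine (log_le_log (by apply div_pos <;> linarith) (h.tau₂_div_tau₁_le hk)).trans ?_
  have h4 := mul_le_mul_of_nonneg_left (log_one_div_le hε hα) (by positivity : 0 ≤ 2 + ε)
  have h5 : (2 + ε) * (2 / ε * (1 / α) ^ (ε / 2)) = (4 / ε + 2) * (1 / α) ^ (ε / 2) := by
    field_simp
    ring
  rw [h3]
  linarith [log_two_lt_d9]

/-- The sum of squares is harmonic and contributes ln n · ln(τ₂/τ₁); wrap-around to positions before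
τ₁ costs only O(ln n). The 160/ε in `threshold` is 20 · 2 · 4/ε: the target G/20, the two sums of
squares, and the 4/ε from the logarithm. -/
lemma sum_prob_collision_le (h : Admissible c ε α n) {k : ℕ} (hk : 2 ≤ k) (hkn : k ≤ n)
    (s : ℤ) :
    ∑ r ∈ rows (numRows c ε α n) (tau₁ c n k) (tau₂ c ε α n k),
      prob n r * prob n (rotate s r) ≤ scale c ε α n / 20 := by
  refine (sum_prob_mul_prob_comp_le n (rotate_injective s) _ _).trans ?_
  have hε := h.eps_pos
  have hL := h.le_log
  have hB := h.one_le_rpow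
  have h1 := h.one_le_tau₁ hk
  have h1' : (1 : ℝ) ≤ tau₁ c n k := by exact_mod_cast h1
  have h2 := sum_prob_sq_le h.two_le h1 (h.tau₁_le_tau₂ hk hkn)
  have h3 := mul_le_mul_of_nonneg_left (h.log_tau₂_div_tau₁_le hk hkn)
    (by linarith : 0 ≤ log n)
  have h4 : prob n (tau₁ c n k) * ∑ r ∈ Finset.Icc 0 (tau₁ c n k), prob n r ≤
      1 + 2 * log n := by
    have hp := prob_le_sqrt h.two_le h1
    have hq := prob_nonneg n (tau₁ c n k)
    have e1 := mul_le_mul_of_nonneg_left (sum_prob_le h.two_le (tau₁ c n k)) hq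
    have e2 := prob_le_one n (tau₁ c n k)
    have e3 : prob n (tau₁ c n k) * (√(log n) * √(tau₁ c n k)) ≤ log n := by
      calc _ ≤ √(log n / tau₁ c n k) * (√(log n) * √(tau₁ c n k)) := by gcongr
        _ = √(log n) * √(log n) := by
            rw [sqrt_div' _ (by linarith)]
            have : √(tau₁ c n k : ℝ) ≠ 0 := (sqrt_pos.2 (by linarith)).ne'
            field_simp
        _ = log n := mul_self_sqrt (by linarith)
    linarith
  have h5 : log n ≤ log n * (1 / α) ^ (ε / 2) := le_mul_of_one_le_right (by linarith) hB
  have h6 : threshold ε * (log n * (1 / α) ^ (ε / 2)) ≤ scale c ε α n := by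
    unfold scale
    rw [mul_assoc]
    have := h.threshold_le_sqrt
    gcongr
  have h7 : threshold ε * (log n * (1 / α) ^ (ε / 2)) =
      8192 * (log n * (1 / α) ^ (ε / 2)) + 160 * (log n * (1 / α) ^ (ε / 2) / ε) := by
    unfold threshold
    ring
  have h8 : log n * ((7 + 4 / ε) * (1 / α) ^ (ε / 2)) =
      7 * (log n * (1 / α) ^ (ε / 2)) + 4 * (log n * (1 / α) ^ (ε / 2) / ε) := by
    ring
  have h9 : 0 ≤ log n * (1 / α) ^ (ε / 2) / ε := by positivity
  linarith

/-! ### The failure probability of one round. -/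

lemma union_bound_le (h : Admissible c ε α n) :
    5 * n ^ 3 * numRows c ε α n * exp (-(scale c ε α n / 5)) ≤ 1 / (n : ℝ) ^ 2 := by
  have hε := h.eps_pos
  have hα := h.alpha_pos
  have hy := h.le_sqrt
  have hL := h.le_log
  have hB := h.one_le_rpow
  have hG := h.le_scale
  have hn : (2 : ℝ) ≤ n := by exact_mod_cast h.two_le
  set G := scale c ε α n with hGdef
  set B := (1 / α) ^ (ε / 2) with hBdef
  have hLB : log n ≤ log n * B := le_mul_of_one_le_right (by linarith) hB
  have hLB' : 69 / 100 * B ≤ log n * B := by gcongr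
  have hGe : G = √c * (log n * B) := by rw [hGdef, scale, mul_assoc]
  -- The exponent G/5 is split into four equal parts, one for each factor of 10 · n⁸ · c · (B/α)².
  have b1 : (10 : ℝ) ≤ exp (G / 20) := by linarith [add_one_le_exp (G / 20)]
  have b2 : (n : ℝ) ^ 8 ≤ exp (G / 20) := by
    rw [← exp_log (by positivity : (0 : ℝ) < n), ← exp_nat_mul]
    refine exp_le_exp.2 ?_
    have : 8192 * (log n * B) ≤ G := by rw [hGe]; gcongr
    push_cast
    linarith
  have b3 : √c ^ 2 ≤ exp (G / 20) := by
    -- The quadratic term of the exponential is c/8192, which exceeds √c once √c ≥ 8192; this is the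
    -- constant in `threshold`.
    have e1 : √c ≤ exp (√c / 64) := by
      have := quadratic_le_exp_of_nonneg (x := √c / 64) (by positivity)
      nlinarith
    calc √c ^ 2 ≤ exp (√c / 64) ^ 2 := by gcongr
      _ = exp (√c / 32) := by
          rw [← exp_nat_mul]
          congr 1
          push_cast
          ring
      _ ≤ _ := by
          refine exp_le_exp.2 ?_
          have : √c * (69 / 100) ≤ G := by rw [hGe]; gcongr; linarith
          linarith
  have b4 : (1 / α * B) ^ 2 ≤ exp (G / 20) := by
    have e1 : 1 / α ≤ exp (2 / ε * B) := by
      rw [← log_le_iff_le_exp (by positivity)]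
      exact log_one_div_le hε hα
    have e2 : B ≤ exp B := by linarith [add_one_le_exp B]
    calc (1 / α * B) ^ 2 ≤ (exp (2 / ε * B) * exp B) ^ 2 := by gcongr
      _ = exp ((4 / ε + 2) * B) := by
          rw [← exp_add, ← exp_nat_mul]
          congr 1
          push_cast
          ring
      _ ≤ _ := by
          refine exp_le_exp.2 ?_
          have f1 : threshold ε * (69 / 100 * B) ≤ G := by
            rw [hGe]
            have := h.threshold_le_sqrt
            gcongr
          have f2 : 0 ≤ B / ε := by positivity
          have f3 : threshold ε * (69 / 100 * B) =
              8192 * (69 / 100) * B + 160 * (69 / 100) * (B / ε) := by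
            unfold threshold
            ring
          have f4 : (4 / ε + 2) * B = 4 * (B / ε) + 2 * B := by ring
          linarith
  have ht := h.numRows_le
  rw [← hBdef] at ht
  have key : 5 * (n : ℝ) ^ 3 * numRows c ε α n * n ^ 2 ≤ exp (G / 5) := by
    calc 5 * (n : ℝ) ^ 3 * numRows c ε α n * n ^ 2
        ≤ 5 * (n : ℝ) ^ 3 * (2 * (√c * (1 / α * B)) ^ 2 * (n : ℝ) ^ 3) * n ^ 2 := by gcongr
      _ = 10 * (n : ℝ) ^ 8 * (√c ^ 2) * (1 / α * B) ^ 2 := by ring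
      _ ≤ exp (G / 20) * exp (G / 20) * exp (G / 20) * exp (G / 20) := by gcongr
      _ = exp (G / 5) := by
          rw [← exp_add, ← exp_add, ← exp_add]
          congr 1
          ring
  rw [le_div_iff₀ (by positivity), exp_neg, ← div_eq_mul_inv, div_mul_eq_mul_div,
    div_le_one (exp_pos _)]
  exact key

lemma measureReal_check_fails_le (h : Admissible c ε α n) :
    (randomMatrix (numRows c ε α n) n).real {M | ¬ (check c ε α M).val = true} ≤
      1 / (n : ℝ) ^ 2 :=
  (URSC.measureReal_check_fails_le h.alpha_pos (by linarith [h.alpha_le_half])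
    (by linarith [h.le_scale]) (fun _ hk _ => h.sum_prob_top_le hk)
    (fun _ hk hkn => h.le_sum_prob_bottom hk hkn)
    (fun _ hk hkn s => h.sum_prob_collision_le hk hkn s)).trans h.union_bound_le

end Admissible

/-! ### The repeated rounds -/

lemma check_of_output_eq_some {c ε α : ℝ} {n : ℕ} {ω : Sample c ε α n}
    {M : Fin (numRows c ε α n) → Fin n → Bool} (h : output ω = some M) :
    (check c ε α M).val = true := by
  classical
  unfold output at h
  split_ifs at h with hex
  rw [← Option.some_injective _ h]
  exact Nat.find_spec hex

lemma isSome_output_iff {c ε α : ℝ} {n : ℕ} {ω : Sample c ε α n} :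
    (output ω).isSome = true ↔ ∃ s, Accepts ω s := by
  unfold output
  split_ifs with hex <;> simp [hex]

/-- The probability that the check fails in one pass. -/
def failureProb (c ε α : ℝ) (n : ℕ) : ENNReal :=
  randomMatrix (numRows c ε α n) n {M | ¬ (check c ε α M).val = true}

/-- Rejection of the first s rounds is a cylinder set of the product measure, so the failure
probabilities multiply. -/
lemma sampleLaw_forall_not_accepts (c ε α : ℝ) (n s : ℕ) :
    sampleLaw c ε α n {ω | ∀ s' < s, ¬ Accepts ω s'} = failureProb c ε α n ^ s := by
  have h : {ω : Sample c ε α n | ∀ s' < s, ¬ Accepts ω s'} =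
      Set.pi (Finset.range s : Set ℕ) fun _ => {M | ¬ (check c ε α M).val = true} := by
    ext ω
    simp [Set.mem_pi, Accepts, iteration_val]
  rw [h, sampleLaw, Measure.infinitePi_pi _ fun _ _ => MeasurableSet.of_discrete]
  simp [failureProb]

instance (c ε α : ℝ) (n : ℕ) : IsProbabilityMeasure (sampleLaw c ε α n) := by
  unfold sampleLaw
  infer_instance

lemma measurableSet_accepts (c ε α : ℝ) (n s : ℕ) :
    MeasurableSet {ω : Sample c ε α n | Accepts ω s} :=
  (measurable_pi_apply (X := fun _ : ℕ => Fin (numRows c ε α n) → Fin n → Bool) s)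
    (MeasurableSet.of_discrete (s := {M | (check c ε α M).val = true}))

lemma measurableSet_forall_not_accepts (c ε α : ℝ) (n s : ℕ) :
    MeasurableSet {ω : Sample c ε α n | ∀ s' < s, ¬ Accepts ω s'} := by
  have h : {ω : Sample c ε α n | ∀ s' < s, ¬ Accepts ω s'} =
      ⋂ s' ∈ Finset.range s, {ω | Accepts ω s'}ᶜ := by
    ext ω
    simp
  rw [h]
  exact Finset.measurableSet_biInter _ fun s' _ => (measurableSet_accepts c ε α n s').compl

lemma ae_isSome_output {c ε α : ℝ} {n : ℕ} (hq : failureProb c ε α n < 1) :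
    ∀ᵐ ω ∂(sampleLaw c ε α n), (output ω).isSome = true := by
  simp only [isSome_output_iff, ae_iff]
  refine le_antisymm (ge_of_tendsto' (ENNReal.tendsto_pow_atTop_nhds_zero_of_lt_one hq)
    fun s => ?_) zero_le
  rw [← sampleLaw_forall_not_accepts]
  refine measure_mono fun ω hω => ?_
  simp only [Set.mem_ofPred_eq, not_exists] at hω ⊢
  exact fun s' _ => hω s'

/-- Round s is executed exactly when the s rounds before it are rejected, so the expected time is at
most 8 plus D times a geometric series of sum at most 2. -/
lemma lintegral_runningTime_le {c ε α : ℝ} {n D : ℕ} (hq : failureProb c ε α n ≤ 2⁻¹)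
    (hD : ∀ bits : Fin (numRows c ε α n) → Fin n → Bool,
      (iteration c ε α bits).steps + 1 ≤ D) :
    ∫⁻ ω, runningTime ω ∂(sampleLaw c ε α n) ≤ ((8 + D * 2 : ℕ) : ENNReal) := by
  classical
  have h1 : ∀ ω : Sample c ε α n, runningTime ω ≤
      8 + ∑' s : ℕ, {ω : Sample c ε α n | ∀ s' < s, ¬ Accepts ω s'}.indicator
        (fun _ => (D : ENNReal)) ω := by
    intro ω
    unfold runningTime
    gcongr with s
    simp only [Set.indicator_apply, Set.mem_ofPred_eq]
    split_ifs
    · exact_mod_cast hD (ω s)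
    · exact le_rfl
  refine (lintegral_mono h1).trans ?_
  rw [lintegral_add_left measurable_const, lintegral_tsum fun s =>
    (measurable_const.indicator (measurableSet_forall_not_accepts c ε α n s)).aemeasurable]
  simp only [lintegral_const, measure_univ, mul_one,
    lintegral_indicator_const (measurableSet_forall_not_accepts c ε α n _),
    sampleLaw_forall_not_accepts]
  rw [ENNReal.tsum_mul_left, ENNReal.tsum_geometric]
  push_cast
  gcongr
  rw [ENNReal.inv_le_iff_inv_le]
  calc (2 : ENNReal)⁻¹ = 1 - 2⁻¹ := by rw [ENNReal.one_sub_inv_two]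
    _ ≤ _ := by gcongr

lemma runningTime_of_accepts_zero {c ε α : ℝ} {n : ℕ} {ω : Sample c ε α n}
    (h : Accepts ω 0) :
    runningTime ω = ((8 + ((iteration c ε α (ω 0)).steps + 1) : ℕ) : ENNReal) := by
  unfold runningTime
  rw [tsum_eq_single 0]
  · simp
  · intro s hs
    rw [if_neg]
    exact fun hcon => hcon 0 (Nat.pos_of_ne_zero hs) h

lemma sampleLaw_real_accepts_zero (c ε α : ℝ) (n : ℕ) :
    (sampleLaw c ε α n).real {ω | Accepts ω 0} =
      1 - (randomMatrix (numRows c ε α n) n).real {M | ¬ (check c ε α M).val = true} := by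
  have h1 : {ω : Sample c ε α n | Accepts ω 0}ᶜ = {ω | ∀ s' < 1, ¬ Accepts ω s'} := by
    ext ω
    simp
  have h2 := probReal_compl_eq_one_sub (μ := sampleLaw c ε α n) (measurableSet_accepts c ε α n 0)
  rw [h1, measureReal_def, sampleLaw_forall_not_accepts, pow_one] at h2
  rw [measureReal_def (randomMatrix _ n)]
  change (failureProb c ε α n).toReal = _ at h2
  change _ = 1 - (failureProb c ε α n).toReal
  linarith

/-! ### Polynomial bounds in n/α. -/

lemma numRows_half_le {c ε α : ℝ} {n : ℕ} (hα : 0 < α) (h : Admissible c ε (α / 2) n) :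
    (numRows c ε (α / 2) n : ℝ) ≤
      2 * c * 2 ^ ⌈2 + ε⌉₊ * ((n : ℝ) / α) ^ (⌈2 + ε⌉₊ + 3) := by
  have hn : (2 : ℝ) ≤ n := by exact_mod_cast h.two_le
  have hα1 : α ≤ 1 := by linarith [h.alpha_le_half]
  have hc := h.c_pos
  refine h.numRows_le.trans ?_
  rw [← h.div_rpow_eq, div_eq_mul_one_div c, one_div (_ ^ _),
    ← inv_rpow (by positivity), ← one_div]
  have h1 : (1 / (α / 2)) ^ (2 + ε) ≤ (2 * (n / α)) ^ ⌈2 + ε⌉₊ := by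
    calc (1 / (α / 2)) ^ (2 + ε) ≤ (1 / (α / 2)) ^ ((⌈2 + ε⌉₊ : ℕ) : ℝ) :=
          rpow_le_rpow_of_exponent_le (by linarith [h.two_le_one_div]) (Nat.le_ceil _)
      _ = (1 / (α / 2)) ^ ⌈2 + ε⌉₊ := rpow_natCast _ _
      _ ≤ _ := by
          have : 1 / (α / 2) = 2 * (1 / α) := by field_simp
          rw [this]
          gcongr
          linarith
  have h2 : (n : ℝ) ≤ n / α := le_div_self (by positivity) hα hα1
  calc 2 * (c * (1 / (α / 2)) ^ (2 + ε)) * (n : ℝ) ^ 3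
      ≤ 2 * (c * (2 * (n / α)) ^ ⌈2 + ε⌉₊) * (n / α) ^ 3 := by gcongr
    _ = _ := by ring

lemma step_bound_half_le {c ε α : ℝ} {n : ℕ} (hα : 0 < α)
    (h : Admissible c ε (α / 2) n) :
    ((72 * n ^ 3 * numRows c ε (α / 2) n ^ 2 : ℕ) : ℝ) ≤
      72 * (2 * c * 2 ^ ⌈2 + ε⌉₊) ^ 2 * ((n : ℝ) / α) ^ (2 * ⌈2 + ε⌉₊ + 9) := by
  have h1 := numRows_half_le hα h
  have hα1 : α ≤ 1 := by linarith [h.alpha_le_half]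
  have hc := h.c_pos
  have h2 : (n : ℝ) ≤ n / α := le_div_self (by positivity) hα hα1
  push_cast
  calc 72 * (n : ℝ) ^ 3 * (numRows c ε (α / 2) n : ℝ) ^ 2
      ≤ 72 * (n / α : ℝ) ^ 3 *
          (2 * c * 2 ^ ⌈2 + ε⌉₊ * ((n : ℝ) / α) ^ (⌈2 + ε⌉₊ + 3)) ^ 2 := by gcongr
    _ = _ := by ring

end URSC

end

/-! ### Assembly of the theorem. -/

theorem theorem1 (ε : ℝ) (hε : 0 < ε) :
    ∃ c₀ : ℝ, 0 < c₀ ∧ ∃ d : ℕ, ∀ c : ℝ, c₀ ≤ c → ∃ C : ℝ, 0 < C ∧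
      ∀ α : ℝ, 0 < α → α ≤ 1 → ∀ n : ℕ, 2 ≤ n →
        -- the elongation is `O((k ^ 2 / α ^ (2 + ε)) ln n)`
        (∀ k : ℕ, 1 < k → k ≤ n →
          (URSC.tau₂ c ε (α / 2) n k : ℝ) ≤ C * ((k : ℝ) ^ 2 / α ^ (2 + ε)) * Real.log n) ∧
        -- whatever the algorithm, run with `α / 2`, returns is an `(n, α)`-URSC
        (∀ (ω : URSC.Sample c ε (α / 2) n) (M : Fin (URSC.numRows c ε (α / 2) n) → Fin n → Bool),
          URSC.output ω = some M → URSC.IsURSC M α (URSC.tau₂ c ε (α / 2))) ∧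
        -- it almost surely returns a matrix
        (∀ᵐ ω ∂(URSC.sampleLaw c ε (α / 2) n), (URSC.output ω).isSome = true) ∧
        -- with high probability it does so in polynomial time
        1 - 1 / (n : ℝ) ^ 2 ≤ (URSC.sampleLaw c ε (α / 2) n).real
          {ω | (∃ M, URSC.output ω = some M ∧ URSC.IsURSC M α (URSC.tau₂ c ε (α / 2))) ∧
            URSC.runningTime ω ≤ ENNReal.ofReal (C * ((n : ℝ) / α) ^ d)} ∧
        -- its expected running time is polynomial
        ∫⁻ ω, URSC.runningTime ω ∂(URSC.sampleLaw c ε (α / 2) n) ≤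
          ENNReal.ofReal (C * ((n : ℝ) / α) ^ d) := by
  refine ⟨URSC.threshold ε ^ 2, pow_pos (URSC.threshold_pos hε) 2, 2 * ⌈2 + ε⌉₊ + 9, fun c hc => ?_⟩
  have hc0 : 0 < c := (pow_pos (URSC.threshold_pos hε) 2).trans_le hc
  -- The first summand serves the elongation, with 2^(2+ε) from halving α. The others bound 8 + 2D =
  -- 10 + 144n³t².
  refine ⟨c * 2 ^ (2 + ε) + 10 + 144 * (2 * c * 2 ^ ⌈2 + ε⌉₊) ^ 2, by positivity,
    fun α hα hα1 n hn => ?_⟩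
  have h : URSC.Admissible c ε (α / 2) n := ⟨hn, hε, by linarith, by linarith, hc⟩
  have hn' : (2 : ℝ) ≤ n := by exact_mod_cast hn
  have ht : 1 ≤ URSC.numRows c ε (α / 2) n := le_trans (by omega) h.le_numRows
  set D := 72 * n ^ 3 * URSC.numRows c ε (α / 2) n ^ 2 + 1 with hD
  have hsteps : ∀ bits, (URSC.iteration c ε (α / 2) bits).steps + 1 ≤ D := fun bits =>
    Nat.add_le_add_right (URSC.iteration_steps_le c ε (α / 2) (by omega) ht bits) 1
  have htime : ((8 + D * 2 : ℕ) : ENNReal) ≤ ENNReal.ofReal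
      ((c * 2 ^ (2 + ε) + 10 + 144 * (2 * c * 2 ^ ⌈2 + ε⌉₊) ^ 2) *
        ((n : ℝ) / α) ^ (2 * ⌈2 + ε⌉₊ + 9)) := by
    rw [← ENNReal.ofReal_natCast]
    refine ENNReal.ofReal_le_ofReal ?_
    have h1 := URSC.step_bound_half_le hα h
    have h2 : 1 ≤ ((n : ℝ) / α) ^ (2 * ⌈2 + ε⌉₊ + 9) :=
      one_le_pow₀ ((by linarith : (1 : ℝ) ≤ n).trans (le_div_self (by positivity) hα hα1))
    have h3 : 0 ≤ c * 2 ^ (2 + ε) * ((n : ℝ) / α) ^ (2 * ⌈2 + ε⌉₊ + 9) := by positivity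
    have h4 : ((8 + D * 2 : ℕ) : ℝ) =
        10 + 2 * ((72 * n ^ 3 * URSC.numRows c ε (α / 2) n ^ 2 : ℕ) : ℝ) := by
      rw [hD]
      push_cast
      ring
    rw [h4]
    linarith
  have hcorrect : ∀ (ω : URSC.Sample c ε (α / 2) n)
      (M : Fin (URSC.numRows c ε (α / 2) n) → Fin n → Bool),
      URSC.output ω = some M → URSC.IsURSC M α (URSC.tau₂ c ε (α / 2)) := fun ω M hM =>
    URSC.isURSC_of_pairInequalities hα hα1 (by omega) h.le_numRows
      ((URSC.check_val ..).1 (URSC.check_of_output_eq_some hM))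
  have hfail := h.measureReal_check_fails_le
  have hq : URSC.failureProb c ε (α / 2) n ≤ 2⁻¹ := by
    have h1 : 1 / (n : ℝ) ^ 2 ≤ 2⁻¹ := by
      rw [one_div]
      exact inv_anti₀ (by norm_num) (by nlinarith)
    have h2 : (URSC.failureProb c ε (α / 2) n).toReal ≤ (2⁻¹ : ENNReal).toReal := by
      rw [ENNReal.toReal_inv, ENNReal.toReal_ofNat]
      exact hfail.trans h1
    exact (ENNReal.toReal_le_toReal (MeasureTheory.measure_ne_top _ _) (by norm_num)).1 h2
  refine ⟨fun k _ _ => ?_, hcorrect,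
    URSC.ae_isSome_output (hq.trans_lt (by norm_num)), ?_,
    (URSC.lintegral_runningTime_le hq hsteps).trans htime⟩
  · refine (h.tau₂_le k).trans ?_
    have hL := h.le_log
    rw [← h.div_rpow_eq, Real.div_rpow hα.le (by norm_num)]
    have h1 : c / (α ^ (2 + ε) / 2 ^ (2 + ε)) * (k : ℝ) ^ 2 * Real.log n =
        c * 2 ^ (2 + ε) * ((k : ℝ) ^ 2 / α ^ (2 + ε)) * Real.log n := by
      field_simp
    rw [h1]
    gcongr
    linarith [sq_nonneg (2 * c * 2 ^ ⌈2 + ε⌉₊)]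
  -- Acceptance in the very first round already has this probability, and then only one round is
  -- paid for.
  · calc 1 - 1 / (n : ℝ) ^ 2 ≤ (URSC.sampleLaw c ε (α / 2) n).real {ω | URSC.Accepts ω 0} := by
          rw [URSC.sampleLaw_real_accepts_zero]
          linarith
      _ ≤ _ := by
          refine MeasureTheory.measureReal_mono (fun ω hω => ?_)
            (MeasureTheory.measure_ne_top _ _)
          obtain ⟨M, hM⟩ := Option.isSome_iff_exists.1 (URSC.isSome_output_iff.2 ⟨0, hω⟩)
          refine ⟨⟨M, hM, hcorrect ω M hM⟩, ?_⟩
          rw [URSC.runningTime_of_accepts_zero hω]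
          refine le_trans ?_ htime
          have := hsteps (ω 0)
          exact_mod_cast (by omega : 8 + ((URSC.iteration c ε (α / 2) (ω 0)).steps + 1) ≤
            8 + D * 2)
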